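/- **Setting.** Types are generated by $\sigma,\tau ::= X \mid N \mid \sigma\times\tau \mid \sigma\to\tau \mid \mu X\,\sigma$, where in each $\mu X\,\sigma$ the body $\sigma$ is positive in $X$ (in the usual sense; not necessarily strictly). Sequents are $\Sigma\Rightarrow\tau$ with $\Sigma$ a list of types. The rules of the system $\mu'\mathsf{LJ}^-$ are - $\mathsf{id}$: $\sigma\Rightarrow\sigma$; - $\mathsf e$: from $\Gamma,\sigma,\tau,\Delta\Rightarrow\gamma$ infer $\Gamma,\tau,\sigma,\Delta\Rightarrow\gamma$; - $\mathsf{cut}$: from $\Gamma\Rightarrow\sigma$ and $\Delta,\sigma\Rightarrow\tau$ infer $\Gamma,\Delta\Rightarrow\tau$; - $\mathsf w$: from $\Gamma\Rightarrow\tau$ infer $\Gamma,\sigma\Rightarrow\tau$; - $\mathsf c$: from $\Gamma,\sigma,\sigma\Rightarrow\tau$ infer $\Gamma,\sigma\Rightarrow\tau$; - ${\to}_r$: from $\Gamma,\sigma\Rightarrow\tau$ infer $\Gamma\Rightarrow\sigma\to\tau$; - ${\to}_l$: from $\Gamma\Rightarrow\sigma$ and $\Delta,\tau\Rightarrow\gamma$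 infer $\Gamma,\Delta,\sigma\to\tau\Rightarrow\gamma$; - $\times_r$: from $\Gamma\Rightarrow\sigma$ and $\Delta\Rightarrow\tau$ infer $\Gamma,\Delta\Rightarrow\sigma\times\tau$; - $\times_l$: from $\Gamma,\sigma,\tau\Rightarrow\gamma$ infer $\Gamma,\sigma\times\tau\Rightarrow\gamma$; - $N^0_r$: $\Rightarrow N$; $N^1_r$: from $\Gamma\Rightarrow N$ infer $\Gamma\Rightarrow N$; $N_l'$: from $\Gamma\Rightarrow\sigma$ and $\Gamma,N\Rightarrow\sigma$ infer $\Gamma,N\Rightarrow\sigma$; - $\mu_r$: from $\Gamma\Rightarrow\sigma(\mu X\sigma)$ infer $\Gamma\Rightarrow\mu X\sigma$; $\mu_l'$: from $\Gamma,\sigma(\mu X\sigma)\Rightarrow\tau$ infer $\Gamma,\mu X\sigma\Rightarrow\tau$. A *coderivation* is a possibly infinite tree generated by these rules; it is *regular* if it has finitely many distinct sub-coderivations. A *thread* along an infinite branch is a path of immediate ancestry between type occurrences: formulas of $\Gamma,\Delta$ and unaffected right-hand formulas are traced to themselves, both copies in $\mathsf c$ are ancestors of the contracted formula, the auxiliary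 formulas of a logical rule are ancestors of its principal formula (for $N_l'$ and $N_r^1$: $N$ in the premiss of $N$ in the conclusion), and cut formulas are not ancestors. The thread is *progressing* if, among the formulas that are infinitely often principal (for a logical rule, i.e. one other than $\mathsf{id}$, $\mathsf{cut}$, $\mathsf e$, $\mathsf w$, $\mathsf c$) along it, there is a smallest one with respect to the subformula order, and this is a $\mu$-type or $N$ that is infinitely often principal on the left-hand side. A coderivation is *progressing* if each infinite branch has a progressing thread. $\mathsf{C\mu LJ}^-$ is the class of regular progressing coderivations. *Coterms* are the possibly infinite expressions $s,t ::= r \mid s\,t$ with $r$ a rule instance (extended by variables $x$, needed only to state extensionality). A coderivation with last step $r$ and immediate sub-coderivations $P_1,\dots,P_n$ is identified with the coterm $r\,P_1\cdots P_n$. Write $\langle s,t\rangle$ for $\times_r\,s\,t$ with empty contexts, $\mathsf s\,t$ for $N_r^1\,t$ with empty context, $\mathsf p_0=\times_l(\mathsf w\,\mathsf{id})$ and $\mathsf p_1=\times_l(\mathsf e(\mathsf w\,\mathsf{id}))$ for the derivations of $\sigma_0\times\sigma_1\Rightarrow\sigma_i$, and $\underline 0=N_r^0$, $\underline{n+1}=\mathsf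 s\,\underline n$. Reduction is given, for vectors $\vec x,\vec y$ of lengths $|\Gamma|,|\Delta|$, by $$\mathsf{id}\,x\leadsto x,\quad \mathsf e\,t\,\vec x\,x\,y\,\vec y\leadsto t\,\vec x\,y\,x\,\vec y,\quad \mathsf w\,t\,\vec x\,x\leadsto t\,\vec x,\quad \mathsf c\,t\,\vec x\,x\leadsto t\,\vec x\,x\,x,\quad \mathsf{cut}\,s\,t\,\vec x\,\vec y\leadsto t\,\vec y\,(s\,\vec x),$$ $$\times_r s\,t\,\vec x\,\vec y\leadsto\langle s\,\vec x,t\,\vec y\rangle,\quad \times_l t\,\vec x\,y\leadsto t\,\vec x\,(\mathsf p_0y)(\mathsf p_1y),\quad \mathsf p_i\langle x_0,x_1\rangle\leadsto x_i,$$ $${\to}_r\,t\,\vec x\,x\leadsto t\,\vec x\,x,\quad {\to}_l\,s\,t\,\vec x\,\vec y\,z\leadsto t\,\vec y\,(z\,(s\,\vec x)),\quad \mu_r\,t\,\vec x\leadsto t\,\vec x,\quad \mu_l'\,t\,\vec x\leadsto t\,\vec x,$$ $$N_r^1\,t\,\vec x\leadsto\mathsf s(t\,\vec x),\quad N_l'\,s\,t\,\vec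 x\,\underline 0\leadsto s\,\vec x,\quad N_l'\,s\,t\,\vec x\,(\mathsf s\,y)\leadsto t\,\vec x\,y$$ (the clause for $\mathsf p_i\langle x_0,x_1\rangle$ applies whatever the type annotations). Let $\approx$ be the least congruence on coterms that contains reduction and is closed under: if $t\,x\approx t'\,x$ for a fresh variable $x$ then $t\approx t'$. Let $\mathcal C$ be the least set of coterms that contains $\mathsf{C\mu LJ}^-$ and is closed under application. A *candidate* is a set $A\subseteq\mathcal C$ such that $t\in A$, $t'\in\mathcal C$, $t\approx t'$ imply $t'\in A$. For an assignment $\rho$ of candidates to the type variables define $[\![\sigma]\!]_\rho\subseteq\mathcal C$ by $$[\![X]\!]_\rho=\rho(X),\qquad [\![N]\!]_\rho=\{t\in\mathcal C\mid\exists n\in\mathbb N.\ t\approx\underline n\},\qquad [\![\sigma\to\tau]\!]_\rho=\{t\in\mathcal C\mid\forall s\in[\![\sigma]\!]_\rho.\ t\,s\in[\![\tau]\!]_\rho\},$$ $$[\![\sigma\times\tau]\!]_\rho=\{t\in\mathcal C\mid\mathsf p_0t\in[\![\sigma]\!]_\rho\text{ and }\mathsf p_1t\in[\![\tau]\!]_\rho\text{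 (for all type annotations of the }\mathsf p_i)\},$$ $$[\![\mu X\sigma]\!]_\rho=\bigcap\{A\text{ a candidate}\mid[\![\sigma]\!]_{\rho[X:=A]}\subseteq A\}.$$ For closed $\sigma$ this does not depend on $\rho$. **Theorem.** Let $\rho$ be an assignment of candidates to the type variables. 1. For every type $\tau$, $[\![\tau]\!]_\rho$ is a candidate; in particular it is closed under $\approx$ within $\mathcal C$. 2. For every type $\mu X\sigma$, $[\![\mu X\sigma]\!]_\rho$ is the least fixed point of the map $A\mapsto[\![\sigma]\!]_{\rho[X:=A]}$ on candidates. 3. (Interpretation) For every $\mathsf{C\mu LJ}^-$-coderivation $P:\sigma_1,\dots,\sigma_n\Rightarrow\tau$ and all $s_1\in[\![\sigma_1]\!]_\rho,\dots,s_n\in[\![\sigma_n]\!]_\rho$, we have $P\,s_1\cdots s_n\in[\![\tau]\!]_\rho$. 4. (Totality) For every $\mathsf{C\mu LJ}^-$-coderivation $P:N^k\Rightarrow N$ and all $m_1,\dots,m_k\in\mathbb N$ there is $n\in\mathbb N$ with $P\,\underline{m_1}\cdots\underline{m_k}\approx\underline n$. Moreover $\mathsf{C\mu LJ}^-$ represents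 only total functions with respect to $\approx$: if a $\mathsf{C\mu LJ}^-$-coderivation $P:N^k\Rightarrow N$ represents a partial function $f:\mathbb N^k\rightharpoonup\mathbb N$, meaning that the coderivation of $\Rightarrow N$ obtained by cutting $P$ against $\underline{m_1},\dots,\underline{m_k}$ is $\approx\underline{f(m_1,\dots,m_k)}$ whenever $f(m_1,\dots,m_k)$ is defined and is $\approx$ to no numeral otherwise, then $f$ is total. -/

import Mathlib

namespace MuLJ

/-! ### Types over `N, ×, →, μ` -/

/-- Pretypes over `N, ×, →, μ`, with de Bruijn indices for the (second-order) type variables: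
`mu σ` binds the variable `0` of `σ`. -/
inductive Ty : Type
  | var (n : ℕ)
  | nat
  | prod (σ τ : Ty)
  | arr (σ τ : Ty)
  | mu (σ : Ty)

namespace Ty

/-- Lifting of a renaming of variables under a binder. -/
def liftRen (f : ℕ → ℕ) : ℕ → ℕ
  | 0 => 0
  | n + 1 => f n + 1

/-- Renaming of free variables. -/
def rename : (ℕ → ℕ) → Ty → Ty
  | f, var n => var (f n)
  | _, nat => nat
  | f, prod σ τ => prod (rename f σ) (rename f τ)
  | f, arr σ τ => arr (rename f σ) (rename f τ)
  | f, mu σ => mu (rename (liftRen f) σ)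

/-- Lifting of a substitution under a binder. -/
def liftSub (s : ℕ → Ty) : ℕ → Ty
  | 0 => var 0
  | n + 1 => rename Nat.succ (s n)

/-- Simultaneous capture-avoiding substitution. -/
def subst : (ℕ → Ty) → Ty → Ty
  | s, var n => s n
  | _, nat => nat
  | s, prod σ τ => prod (subst s σ) (subst s τ)
  | s, arr σ τ => arr (subst s σ) (subst s τ)
  | s, mu σ => mu (subst (liftSub s) σ)

/-- `inst σ τ` is `σ(τ)`: the variable `0` of `σ` is replaced by `τ`. -/
def inst (σ τ : Ty) : Ty :=
  subst (fun n => match n with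
    | 0 => τ
    | m + 1 => var m) σ

/-- `Polar true k σ`: `σ` is positive in the variable `k`; `Polar false k σ`: it is negative in
the variable `k`. A type in which `k` does not occur is both. -/
def Polar : Bool → ℕ → Ty → Prop
  | b, k, var n => b = true ∨ n ≠ k
  | _, _, nat => True
  | b, k, prod σ τ => Polar b k σ ∧ Polar b k τ
  | b, k, arr σ τ => Polar (!b) k σ ∧ Polar b k τ
  | b, k, mu σ => Polar b (k + 1) σ

/-- A pretype is a type if the body of each `μ` is positive in the bound variable. -/
def IsType : Ty → Prop
  | var _ => True
  | nat => True
  | prod σ τ => IsType σ ∧ IsType τ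
  | arr σ τ => IsType σ ∧ IsType τ
  | mu σ => Polar true 0 σ ∧ IsType σ

/-- `Subformula φ ψ`: `φ` occurs in `ψ` (with no free variable of `φ` bound in `ψ`). -/
inductive Subformula : Ty → Ty → Prop
  | refl (φ : Ty) : Subformula φ φ
  | prodLeft {φ σ : Ty} (τ : Ty) : Subformula φ σ → Subformula φ (prod σ τ)
  | prodRight {φ τ : Ty} (σ : Ty) : Subformula φ τ → Subformula φ (prod σ τ)
  | arrLeft {φ σ : Ty} (τ : Ty) : Subformula φ σ → Subformula φ (arr σ τ)
  | arrRight {φ τ : Ty} (σ : Ty) : Subformula φ τ → Subformula φ (arr σ τ)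
  | mu {φ σ : Ty} : Subformula (rename Nat.succ φ) σ → Subformula φ (mu σ)

/-- The `μ`-formulas of the negative fragment. The primitive type `N` stands for `μX(1 + X)`. -/
def IsMu : Ty → Prop
  | nat => True
  | mu _ => True
  | _ => False

end Ty

/-! ### Inference steps -/

/-- A sequent `Σ ⇒ τ`. -/
structure Sequent : Type where
  ant : List Ty
  suc : Ty

/-- The inference steps (rule instances) of the negative fragment of `μ'LJ`. -/
inductive Rule : Type
  | id (σ : Ty)
  | exch (Γ : List Ty) (τ σ : Ty) (Δ : List Ty) (γ : Ty)
  | cut (Γ Δ : List Ty) (σ τ : Ty)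
  | weak (Γ : List Ty) (σ τ : Ty)
  | contr (Γ : List Ty) (σ τ : Ty)
  | arrR (Γ : List Ty) (σ τ : Ty)
  | arrL (Γ Δ : List Ty) (σ τ γ : Ty)
  | prodR (Γ Δ : List Ty) (σ τ : Ty)
  | prodL (Γ : List Ty) (σ τ γ : Ty)
  | natZero
  | natSucc (Γ : List Ty)
  | natL (Γ : List Ty) (σ : Ty)
  | muR (Γ : List Ty) (σ : Ty)
  | muL (Γ : List Ty) (σ τ : Ty)

namespace Rule

/-- The conclusion of a step. -/
def concl : Rule → Sequent
  | id σ => ⟨[σ], σ⟩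
  | exch Γ τ σ Δ γ => ⟨Γ ++ [τ, σ] ++ Δ, γ⟩
  | cut Γ Δ _ τ => ⟨Γ ++ Δ, τ⟩
  | weak Γ σ τ => ⟨Γ ++ [σ], τ⟩
  | contr Γ σ τ => ⟨Γ ++ [σ], τ⟩
  | arrR Γ σ τ => ⟨Γ, .arr σ τ⟩
  | arrL Γ Δ σ τ γ => ⟨Γ ++ Δ ++ [.arr σ τ], γ⟩
  | prodR Γ Δ σ τ => ⟨Γ ++ Δ, .prod σ τ⟩
  | prodL Γ σ τ γ => ⟨Γ ++ [.prod σ τ], γ⟩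
  | natZero => ⟨[], .nat⟩
  | natSucc Γ => ⟨Γ, .nat⟩
  | natL Γ σ => ⟨Γ ++ [.nat], σ⟩
  | muR Γ σ => ⟨Γ, .mu σ⟩
  | muL Γ σ τ => ⟨Γ ++ [.mu σ], τ⟩

/-- The premisses of a step, from left to right. -/
def prems : Rule → List Sequent
  | id _ => []
  | exch Γ τ σ Δ γ => [⟨Γ ++ [σ, τ] ++ Δ, γ⟩]
  | cut Γ Δ σ τ => [⟨Γ, σ⟩, ⟨Δ ++ [σ], τ⟩]
  | weak Γ _ τ => [⟨Γ, τ⟩]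
  | contr Γ σ τ => [⟨Γ ++ [σ, σ], τ⟩]
  | arrR Γ σ τ => [⟨Γ ++ [σ], τ⟩]
  | arrL Γ Δ σ τ γ => [⟨Γ, σ⟩, ⟨Δ ++ [τ], γ⟩]
  | prodR Γ Δ σ τ => [⟨Γ, σ⟩, ⟨Δ, τ⟩]
  | prodL Γ σ τ γ => [⟨Γ ++ [σ, τ], γ⟩]
  | natZero => []
  | natSucc Γ => [⟨Γ, .nat⟩]
  | natL Γ σ => [⟨Γ, σ⟩, ⟨Γ ++ [.nat], σ⟩]
  | muR Γ σ => [⟨Γ, σ.inst (.mu σ)⟩]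
  | muL Γ σ τ => [⟨Γ ++ [σ.inst (.mu σ)], τ⟩]

/-- The number of premisses. -/
def arity (r : Rule) : ℕ := r.prems.length

/-- All pretypes in the sequents of the step are types. -/
def WellFormed (r : Rule) : Prop :=
  ∀ S ∈ r.concl :: r.prems, (∀ σ ∈ S.ant, σ.IsType) ∧ S.suc.IsType

end Rule

/-- A type occurrence in a sequent: the `i`-th one (counted from `0`) on the left, or the one on
the right. -/
inductive Occ : Type
  | lhs (i : ℕ)
  | rhs

/-- The type at an occurrence, if there is one. -/
def Sequent.typeAt (S : Sequent) : Occ → Option Ty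
  | .lhs i => S.ant[i]?
  | .rhs => some S.suc

/-- The principal occurrence in the conclusion of a step. Identity, cut and the structural steps
have none. -/
def Rule.principal : Rule → Option Occ
  | .id _ => none
  | .exch _ _ _ _ _ => none
  | .cut _ _ _ _ => none
  | .weak _ _ _ => none
  | .contr _ _ _ => none
  | .arrR _ _ _ => some .rhs
  | .arrL Γ Δ _ _ _ => some (.lhs (Γ.length + Δ.length))
  | .prodR _ _ _ _ => some .rhs
  | .prodL Γ _ _ _ => some (.lhs Γ.length)
  | .natZero => some .rhs
  | .natSucc _ => some .rhs
  | .natL Γ _ => some (.lhs Γ.length)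
  | .muR _ _ => some .rhs
  | .muL Γ _ _ => some (.lhs Γ.length)

/-- `Ancestor r j p q`: the occurrence `q` in premiss number `j` of `r` is an immediate ancestor of
the occurrence `p` in the conclusion of `r`. -/
inductive Ancestor : Rule → ℕ → Occ → Occ → Prop
  | exchL {Γ τ σ Δ γ} (i : ℕ) : i < Γ.length →
      Ancestor (.exch Γ τ σ Δ γ) 0 (.lhs i) (.lhs i)
  | exchFst {Γ τ σ Δ γ} :
      Ancestor (.exch Γ τ σ Δ γ) 0 (.lhs Γ.length) (.lhs (Γ.length + 1))
  | exchSnd {Γ τ σ Δ γ} :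
      Ancestor (.exch Γ τ σ Δ γ) 0 (.lhs (Γ.length + 1)) (.lhs Γ.length)
  | exchR {Γ τ σ Δ γ} (i : ℕ) : i < Δ.length →
      Ancestor (.exch Γ τ σ Δ γ) 0 (.lhs (Γ.length + 2 + i)) (.lhs (Γ.length + 2 + i))
  | exchSuc {Γ τ σ Δ γ} : Ancestor (.exch Γ τ σ Δ γ) 0 .rhs .rhs
  | cutL {Γ Δ σ τ} (i : ℕ) : i < Γ.length →
      Ancestor (.cut Γ Δ σ τ) 0 (.lhs i) (.lhs i)
  | cutR {Γ Δ σ τ} (i : ℕ) : i < Δ.length →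
      Ancestor (.cut Γ Δ σ τ) 1 (.lhs (Γ.length + i)) (.lhs i)
  | cutSuc {Γ Δ σ τ} : Ancestor (.cut Γ Δ σ τ) 1 .rhs .rhs
  | weakL {Γ σ τ} (i : ℕ) : i < Γ.length →
      Ancestor (.weak Γ σ τ) 0 (.lhs i) (.lhs i)
  | weakSuc {Γ σ τ} : Ancestor (.weak Γ σ τ) 0 .rhs .rhs
  | contrL {Γ σ τ} (i : ℕ) : i < Γ.length →
      Ancestor (.contr Γ σ τ) 0 (.lhs i) (.lhs i)
  | contrFst {Γ σ τ} :
      Ancestor (.contr Γ σ τ) 0 (.lhs Γ.length) (.lhs Γ.length)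
  | contrSnd {Γ σ τ} :
      Ancestor (.contr Γ σ τ) 0 (.lhs Γ.length) (.lhs (Γ.length + 1))
  | contrSuc {Γ σ τ} : Ancestor (.contr Γ σ τ) 0 .rhs .rhs
  | arrRL {Γ σ τ} (i : ℕ) : i < Γ.length →
      Ancestor (.arrR Γ σ τ) 0 (.lhs i) (.lhs i)
  | arrRDom {Γ σ τ} : Ancestor (.arrR Γ σ τ) 0 .rhs (.lhs Γ.length)
  | arrRCod {Γ σ τ} : Ancestor (.arrR Γ σ τ) 0 .rhs .rhs
  | arrLL {Γ Δ σ τ γ} (i : ℕ) : i < Γ.length →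
      Ancestor (.arrL Γ Δ σ τ γ) 0 (.lhs i) (.lhs i)
  | arrLDom {Γ Δ σ τ γ} :
      Ancestor (.arrL Γ Δ σ τ γ) 0 (.lhs (Γ.length + Δ.length)) .rhs
  | arrLR {Γ Δ σ τ γ} (i : ℕ) : i < Δ.length →
      Ancestor (.arrL Γ Δ σ τ γ) 1 (.lhs (Γ.length + i)) (.lhs i)
  | arrLCod {Γ Δ σ τ γ} :
      Ancestor (.arrL Γ Δ σ τ γ) 1 (.lhs (Γ.length + Δ.length)) (.lhs Δ.length)
  | arrLSuc {Γ Δ σ τ γ} : Ancestor (.arrL Γ Δ σ τ γ) 1 .rhs .rhs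
  | prodRL {Γ Δ σ τ} (i : ℕ) : i < Γ.length →
      Ancestor (.prodR Γ Δ σ τ) 0 (.lhs i) (.lhs i)
  | prodRFst {Γ Δ σ τ} : Ancestor (.prodR Γ Δ σ τ) 0 .rhs .rhs
  | prodRR {Γ Δ σ τ} (i : ℕ) : i < Δ.length →
      Ancestor (.prodR Γ Δ σ τ) 1 (.lhs (Γ.length + i)) (.lhs i)
  | prodRSnd {Γ Δ σ τ} : Ancestor (.prodR Γ Δ σ τ) 1 .rhs .rhs
  | prodLL {Γ σ τ γ} (i : ℕ) : i < Γ.length →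
      Ancestor (.prodL Γ σ τ γ) 0 (.lhs i) (.lhs i)
  | prodLFst {Γ σ τ γ} :
      Ancestor (.prodL Γ σ τ γ) 0 (.lhs Γ.length) (.lhs Γ.length)
  | prodLSnd {Γ σ τ γ} :
      Ancestor (.prodL Γ σ τ γ) 0 (.lhs Γ.length) (.lhs (Γ.length + 1))
  | prodLSuc {Γ σ τ γ} : Ancestor (.prodL Γ σ τ γ) 0 .rhs .rhs
  | natSuccL {Γ} (i : ℕ) : i < Γ.length →
      Ancestor (.natSucc Γ) 0 (.lhs i) (.lhs i)
  | natSuccSuc {Γ} : Ancestor (.natSucc Γ) 0 .rhs .rhs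
  | natLZeroL {Γ σ} (i : ℕ) : i < Γ.length →
      Ancestor (.natL Γ σ) 0 (.lhs i) (.lhs i)
  | natLZeroSuc {Γ σ} : Ancestor (.natL Γ σ) 0 .rhs .rhs
  | natLSuccL {Γ σ} (i : ℕ) : i < Γ.length →
      Ancestor (.natL Γ σ) 1 (.lhs i) (.lhs i)
  | natLSuccNat {Γ σ} :
      Ancestor (.natL Γ σ) 1 (.lhs Γ.length) (.lhs Γ.length)
  | natLSuccSuc {Γ σ} : Ancestor (.natL Γ σ) 1 .rhs .rhs
  | muRL {Γ σ} (i : ℕ) : i < Γ.length →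
      Ancestor (.muR Γ σ) 0 (.lhs i) (.lhs i)
  | muRSuc {Γ σ} : Ancestor (.muR Γ σ) 0 .rhs .rhs
  | muLL {Γ σ τ} (i : ℕ) : i < Γ.length →
      Ancestor (.muL Γ σ τ) 0 (.lhs i) (.lhs i)
  | muLMu {Γ σ τ} :
      Ancestor (.muL Γ σ τ) 0 (.lhs Γ.length) (.lhs Γ.length)
  | muLSuc {Γ σ τ} : Ancestor (.muL Γ σ τ) 0 .rhs .rhs

/-! ### Coderivations -/

/-- The functor whose final coalgebra consists of the possibly infinite trees labelled by inference
steps, where a node has as many children as its label has premisses. -/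
def RuleFunctor : PFunctor.{0, 0} := ⟨Rule, fun r => Fin r.arity⟩

/-- Possibly infinite trees of inference steps (not necessarily matching up). -/
def RuleTree : Type := PFunctor.M RuleFunctor

namespace RuleTree

/-- The last inference step, at the root. -/
def root (P : RuleTree) : Rule := (PFunctor.M.dest P).1

/-- The immediate subtrees. -/
def child (P : RuleTree) (i : Fin P.root.arity) : RuleTree := (PFunctor.M.dest P).2 i

/-- The conclusion, at the root. -/
def concl (P : RuleTree) : Sequent := P.root.concl

/-- `Sub P Q`: `Q` is the subtree of `P` at one of the nodes of `P`. -/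
inductive Sub : RuleTree → RuleTree → Prop
  | refl (P : RuleTree) : Sub P P
  | step {P Q : RuleTree} (i : Fin P.root.arity) : Sub (P.child i) Q → Sub P Q

/-- Coderivations: all labels are steps between sequents of types, and the conclusions of the
children of a node are the premisses of its label. -/
def IsCoderivation (P : RuleTree) : Prop :=
  ∀ Q, Sub P Q → Q.root.WellFormed ∧
    ∀ i : Fin Q.root.arity, Q.root.prems[(i : ℕ)]? = some (Q.child i).concl

/-- Regularity: there are only finitely many distinct sub-coderivations. -/
def IsRegular (P : RuleTree) : Prop := {Q | Sub P Q}.Finite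

/-- An infinite branch of `P`: `Q n` is the subtree at its `n`-th node, and `b n` is the number of
the premiss that it follows from there. -/
def IsBranch (P : RuleTree) (Q : ℕ → RuleTree) (b : ℕ → ℕ) : Prop :=
  Q 0 = P ∧ ∀ n, ∃ h : b n < (Q n).root.arity, Q (n + 1) = (Q n).child ⟨b n, h⟩

/-- An infinite thread along a branch, from its `k`-th node on. -/
def IsThread (Q : ℕ → RuleTree) (b : ℕ → ℕ) (k : ℕ) (θ : ℕ → Occ) : Prop :=
  ∀ n, k ≤ n → Ancestor (Q n).root (b n) (θ n) (θ (n + 1))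

/-- The thread is at an occurrence of `φ` that is principal, at the `n`-th node of the branch. -/
def PrincipalAt (Q : ℕ → RuleTree) (θ : ℕ → Occ) (φ : Ty) (n : ℕ) : Prop :=
  (Q n).root.principal = some (θ n) ∧ (Q n).concl.typeAt (θ n) = some φ

/-- The thread has a smallest infinitely often principal formula, with respect to the subformula
order, and this is a `μ`-formula on the left-hand side. -/
def ThreadProgresses (Q : ℕ → RuleTree) (θ : ℕ → Occ) : Prop :=
  ∃ φ : Ty, φ.IsMu ∧
    (∃ᶠ n in Filter.atTop, PrincipalAt Q θ φ n ∧ ∃ i, θ n = .lhs i) ∧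
    ∀ ψ, (∃ᶠ n in Filter.atTop, PrincipalAt Q θ ψ n) → Ty.Subformula φ ψ

/-- Every infinite branch has a progressing thread. -/
def IsProgressing (P : RuleTree) : Prop :=
  ∀ Q b, IsBranch P Q b → ∃ k θ, IsThread Q b k θ ∧ ThreadProgresses Q θ

/-- The circular system `CμLJ⁻`: the regular progressing coderivations over `N, ×, →, μ`. -/
def IsCMuLJ (P : RuleTree) : Prop := P.IsCoderivation ∧ P.IsRegular ∧ P.IsProgressing

end RuleTree

/-! ### Coterms -/

/-- The possible labels at the root of a coterm. -/
inductive CotermHead : Type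
  | app
  | step (r : Rule)
  | var (x : ℕ)

/-- An application has two immediate subterms, numbered by `false` (function) and `true`
(argument). -/
def CotermHead.Child : CotermHead → Type
  | .app => Bool
  | .step _ => Empty
  | .var _ => Empty

/-- The functor whose final coalgebra consists of the coterms. -/
def CotermFunctor : PFunctor.{0, 0} := ⟨CotermHead, CotermHead.Child⟩

/-- Coterms: the possibly infinite expressions generated by `s, t ::= r | s t`, where `r` varies
over inference steps. There are also variables `x`, which only serve to state extensionality. -/
def Coterm : Type := PFunctor.M CotermFunctor

namespace Coterm

/-- An inference step, as a constant. -/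
def step (r : Rule) : Coterm := PFunctor.M.mk (F := CotermFunctor) ⟨.step r, Empty.elim⟩

/-- A variable. -/
def var (x : ℕ) : Coterm := PFunctor.M.mk (F := CotermFunctor) ⟨.var x, Empty.elim⟩

/-- The application `s t`. -/
def app (s t : Coterm) : Coterm :=
  PFunctor.M.mk (F := CotermFunctor) ⟨.app, fun b : Bool => cond b t s⟩

/-- The iterated application `t s₁ ⋯ sₙ`. -/
def apps (t : Coterm) (ss : List Coterm) : Coterm := ss.foldl app t

/-- The variable `x` occurs in a coterm. -/
inductive Occurs (x : ℕ) : Coterm → Prop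
  | var : Occurs x (var x)
  | left {s : Coterm} (t : Coterm) : Occurs x s → Occurs x (app s t)
  | right (s : Coterm) {t : Coterm} : Occurs x t → Occurs x (app s t)

/-- The pairing `⟨s, t⟩`, at any choice of the types: a right `×`-step with empty contexts. -/
def pair (σ τ : Ty) (s t : Coterm) : Coterm := apps (step (.prodR [] [] σ τ)) [s, t]

/-- The projection `p₀`, as the derivation of `σ × τ ⇒ σ`. -/
def proj₀ (σ τ : Ty) : Coterm :=
  app (step (.prodL [] σ τ σ)) (app (step (.weak [σ] τ σ)) (step (.id σ)))

/-- The projection `p₁`, as the derivation of `σ × τ ⇒ τ`. -/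
def proj₁ (σ τ : Ty) : Coterm :=
  app (step (.prodL [] σ τ τ)) (app (step (.exch [] σ τ [] τ))
    (app (step (.weak [τ] σ τ)) (step (.id τ))))

/-- `succ t`: the right successor step with empty context, applied to `t`. -/
def succ (t : Coterm) : Coterm := app (step (.natSucc [])) t

/-- The numerals. -/
def numeral : ℕ → Coterm
  | 0 => step .natZero
  | n + 1 => succ (numeral n)

/-- The clauses of reduction. They depend on the types in the steps only through the lengths of the
contexts `Γ` and `Δ`. -/
inductive Red : Coterm → Coterm → Prop
  | id {σ} (x : Coterm) : Red (app (step (.id σ)) x) x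
  | exch {Γ τ σ Δ γ} (t x y : Coterm) (xs ys : List Coterm) :
      xs.length = Γ.length → ys.length = Δ.length →
      Red (apps (step (.exch Γ τ σ Δ γ)) ([t] ++ xs ++ [x, y] ++ ys)) (apps t (xs ++ [y, x] ++ ys))
  | weak {Γ σ τ} (t x : Coterm) (xs : List Coterm) : xs.length = Γ.length →
      Red (apps (step (.weak Γ σ τ)) ([t] ++ xs ++ [x])) (apps t xs)
  | contr {Γ σ τ} (t x : Coterm) (xs : List Coterm) : xs.length = Γ.length →
      Red (apps (step (.contr Γ σ τ)) ([t] ++ xs ++ [x])) (apps t (xs ++ [x, x]))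
  | cut {Γ Δ σ τ} (s t : Coterm) (xs ys : List Coterm) :
      xs.length = Γ.length → ys.length = Δ.length →
      Red (apps (step (.cut Γ Δ σ τ)) ([s, t] ++ xs ++ ys)) (apps t (ys ++ [apps s xs]))
  | prodR {Γ Δ σ τ} (s t : Coterm) (xs ys : List Coterm) :
      xs.length = Γ.length → ys.length = Δ.length →
      Red (apps (step (.prodR Γ Δ σ τ)) ([s, t] ++ xs ++ ys)) (pair σ τ (apps s xs) (apps t ys))
  | prodL {Γ σ τ γ} (t y : Coterm) (xs : List Coterm) : xs.length = Γ.length →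
      Red (apps (step (.prodL Γ σ τ γ)) ([t] ++ xs ++ [y]))
        (apps t (xs ++ [app (proj₀ σ τ) y, app (proj₁ σ τ) y]))
  | proj₀ {σ τ σ' τ'} (x y : Coterm) : Red (app (proj₀ σ τ) (pair σ' τ' x y)) x
  | proj₁ {σ τ σ' τ'} (x y : Coterm) : Red (app (proj₁ σ τ) (pair σ' τ' x y)) y
  | arrR {Γ σ τ} (t x : Coterm) (xs : List Coterm) : xs.length = Γ.length →
      Red (apps (step (.arrR Γ σ τ)) ([t] ++ xs ++ [x])) (apps t (xs ++ [x]))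
  | arrL {Γ Δ σ τ γ} (s t z : Coterm) (xs ys : List Coterm) :
      xs.length = Γ.length → ys.length = Δ.length →
      Red (apps (step (.arrL Γ Δ σ τ γ)) ([s, t] ++ xs ++ ys ++ [z]))
        (apps t (ys ++ [app z (apps s xs)]))
  | muR {Γ σ} (t : Coterm) (xs : List Coterm) : xs.length = Γ.length →
      Red (apps (step (.muR Γ σ)) ([t] ++ xs)) (apps t xs)
  | muL {Γ σ τ} (t : Coterm) (xs : List Coterm) : xs.length = Γ.length →
      Red (apps (step (.muL Γ σ τ)) ([t] ++ xs)) (apps t xs)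
  | natSucc {Γ} (t : Coterm) (xs : List Coterm) : xs.length = Γ.length →
      Red (apps (step (.natSucc Γ)) ([t] ++ xs)) (succ (apps t xs))
  | natLZero {Γ σ} (s t : Coterm) (xs : List Coterm) : xs.length = Γ.length →
      Red (apps (step (.natL Γ σ)) ([s, t] ++ xs ++ [numeral 0])) (apps s xs)
  | natLSucc {Γ σ} (s t y : Coterm) (xs : List Coterm) : xs.length = Γ.length →
      Red (apps (step (.natL Γ σ)) ([s, t] ++ xs ++ [succ y])) (apps t (xs ++ [y]))

/-- Extensional conversion: the least congruence (with respect to application) that contains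
reduction and is closed under the rule `t x ≈ t' x ⟹ t ≈ t'` for fresh variables `x`. -/
inductive Conv : Coterm → Coterm → Prop
  | red {s t : Coterm} : Red s t → Conv s t
  | refl (t : Coterm) : Conv t t
  | symm {s t : Coterm} : Conv s t → Conv t s
  | trans {s t u : Coterm} : Conv s t → Conv t u → Conv s u
  | app {s s' t t' : Coterm} : Conv s s' → Conv t t' → Conv (app s t) (app s' t')
  | ext {t t' : Coterm} (x : ℕ) : ¬ Occurs x t → ¬ Occurs x t' →
      Conv (app t (var x)) (app t' (var x)) → Conv t t'

end Coterm

/-! ### Coderivations as coterms -/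

namespace RuleTree

/-- Corecursion step for `spine`. -/
def spineStep : RuleTree × ℕ → CotermFunctor (RuleTree × ℕ)
  | (P, 0) => ⟨.step P.root, Empty.elim⟩
  | (P, k + 1) =>
    if h : k < P.root.arity then
      ⟨.app, fun b : Bool => cond b (P.child ⟨k, h⟩, (P.child ⟨k, h⟩).root.arity) (P, k)⟩
    else ⟨.step P.root, Empty.elim⟩

/-- `spine (P, k)` is the coterm `r P₁ ⋯ Pₖ`, where `r` is the last step of `P` and `P₁, …, Pₖ` are
its first `k` immediate subtrees, themselves read as coterms. -/
def spine : RuleTree × ℕ → Coterm := PFunctor.M.corec spineStep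

/-- The tree `P` with last step `r` and immediate subtrees `P₁, …, Pₙ`, read as the coterm
`r P₁ ⋯ Pₙ`. See `toCoterm_eq`. -/
def toCoterm (P : RuleTree) : Coterm := spine (P, P.root.arity)

theorem spine_zero (P : RuleTree) : spine (P, 0) = Coterm.step P.root := by
  have h := PFunctor.M.dest_corec spineStep (P, 0)
  rw [← PFunctor.M.mk_dest (F := CotermFunctor) (spine (P, 0))]
  unfold spine Coterm.step
  rw [h]
  simp only [spineStep]
  congr 1
  refine congrArg (Sigma.mk _) ?_
  funext x
  exact Empty.elim x

theorem spine_succ (P : RuleTree) (k : ℕ) (h : k < P.root.arity) :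
    spine (P, k + 1) = Coterm.app (spine (P, k)) (toCoterm (P.child ⟨k, h⟩)) := by
  have e := PFunctor.M.dest_corec spineStep (P, k + 1)
  rw [← PFunctor.M.mk_dest (F := CotermFunctor) (spine (P, k + 1))]
  unfold toCoterm spine Coterm.app
  rw [e, show spineStep (P, k + 1) = (⟨.app, fun b : Bool =>
    cond b (P.child ⟨k, h⟩, (P.child ⟨k, h⟩).root.arity) (P, k)⟩ :
      CotermFunctor (RuleTree × ℕ)) from dif_pos h]
  congr 1
  refine congrArg (Sigma.mk _) ?_
  funext b
  change Bool at b
  cases b <;> rfl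

/-- The defining equation of `toCoterm`. -/
theorem toCoterm_eq (P : RuleTree) :
    P.toCoterm =
      Coterm.apps (Coterm.step P.root) (List.ofFn fun i => (P.child i).toCoterm) := by
  have key : ∀ k (hk : k ≤ P.root.arity), spine (P, k) = Coterm.apps (Coterm.step P.root)
      (List.ofFn fun i : Fin k => (P.child ⟨i, i.2.trans_le hk⟩).toCoterm) := by
    intro k
    induction k with
    | zero => intro _; simp [spine_zero, Coterm.apps]
    | succ k ih =>
      intro hk
      rw [spine_succ P k hk, ih (Nat.le_of_succ_le hk), List.ofFn_succ_last]
      simp [Coterm.apps]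
  exact key _ le_rfl

end RuleTree

namespace Coterm

/-- The closure of `CμLJ⁻`: the least set of coterms that contains the `CμLJ⁻`-coderivations and is
closed under application. -/
inductive InClosure : Coterm → Prop
  | base {P : RuleTree} : P.IsCMuLJ → InClosure P.toCoterm
  | app {s t : Coterm} : InClosure s → InClosure t → InClosure (app s t)

end Coterm

/-! ### The type structure -/

open Coterm

/-- A (totality) candidate: a set of coterms in the closure of `CμLJ⁻` that is closed under
conversion (among those coterms). -/
def IsCandidate (A : Set Coterm) : Prop :=
  (∀ t ∈ A, InClosure t) ∧ ∀ t ∈ A, ∀ t', InClosure t' → Conv t t' → t' ∈ A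

/-- Extension of an assignment of candidates to the type variables by `A` for the variable `0`. -/
def extend (A : Set Coterm) (ρ : ℕ → Set Coterm) : ℕ → Set Coterm
  | 0 => A
  | n + 1 => ρ n

/-- The type structure, where `ρ` assigns candidates to the free type variables. In the clause for
`×` the omitted type subscripts of the projections are arbitrary. -/
def interp : Ty → (ℕ → Set Coterm) → Set Coterm
  | .var n, ρ => ρ n
  | .nat, _ => {t | InClosure t ∧ ∃ n, Conv t (numeral n)}
  | .prod σ τ, ρ => {t | InClosure t ∧ ∀ σ' τ' : Ty, σ'.IsType → τ'.IsType →
      app (proj₀ σ' τ') t ∈ interp σ ρ ∧ app (proj₁ σ' τ') t ∈ interp τ ρ}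
  | .arr σ τ, ρ => {t | InClosure t ∧ ∀ s ∈ interp σ ρ, app t s ∈ interp τ ρ}
  | .mu σ, ρ => ⋂₀ {A | IsCandidate A ∧ interp σ (extend A ρ) ⊆ A}

/-! ### Representability -/

/-- The coterm of the coderivation obtained from one of `Nᵏ ⇒ N` by cutting its last inputs against
the numerals of a list, so that `d` inputs remain. -/
def cutNumerals (t : Coterm) : ℕ → List ℕ → Coterm
  | _, [] => t
  | d, m :: ms => apps (step (.cut [] (List.replicate d .nat) .nat .nat))
      [numeral m, cutNumerals t (d + 1) ms]

/-- The coderivation `P` of `Nᵏ ⇒ N` represents the partial function `f`, with respect to extensional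
conversion: `P` cut against the numerals for `m₁, …, mₖ` converts to the numeral for
`f(m₁, …, mₖ)` if this is defined, and to no numeral otherwise. -/
def Represents {k : ℕ} (P : RuleTree) (f : (Fin k → ℕ) →. ℕ) : Prop :=
  P.concl = ⟨List.replicate k .nat, .nat⟩ ∧ ∀ m : Fin k → ℕ,
    (∀ n ∈ f m, Conv (cutNumerals P.toCoterm 0 (List.ofFn m)) (numeral n)) ∧
    (¬ (f m).Dom → ∀ n, ¬ Conv (cutNumerals P.toCoterm 0 (List.ofFn m)) (numeral n))

end MuLJ

/-! The interpretation theorem is proved by contradiction, through an infinite descent along a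
progressing thread. Fixed points are annotated by ordinals standing for approximants: the positive
ones in types on the left of a sequent, the negative ones in the type on the right (`ATy`, `Signed`,
`interpA`). Annotation by closure ordinals loses nothing, so a failing coderivation is one whose
conclusion is refuted for some annotation (`interp_annot`, `Refutes`).

Local soundness (`Refutes.premiss`): a refuted conclusion has a refuted premiss whose annotations
agree with the old ones along ancestry, except that the annotation of an unfolded fixed point, if
present, strictly decreases. For a left unfolding this holds because membership in stage `α` is
witnessed at some `β < α`; for a right unfolding, which carries no annotation, the least fixed point
need only be closed under its operator. Iteration gives an infinite branch of counterexamples.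

Take a progressing thread on it, with smallest infinitely often principal formula `φ`. By regularity
only finitely many formulas are ever principal, so from some node on all of those principal on the
thread contain `φ`. The invariant is `ATy.Bounded`: each copy of `φ` inside the traced type is
annotated by an ordinal at most `β`. It starts at a left unfolding of `φ`, survives unfoldings of
other formulas at least as large as `φ` (`ATy.Bounded.desc`), and improves to some `β' < β` whenever
`φ` is unfolded (`ATy.Bounded.desc_self`). As `φ` is unfolded infinitely often, the ordinals would
descend forever.

Monotonicity in positive variables makes `μ`-types least fixed points on candidates. Totality is the
interpretation theorem at `N`, and cutting against numerals converts to application to them. -/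

namespace MuLJ

/-! ### Trees through their immediate subtrees -/

namespace RuleTree

/-- The tree with last step `r` and the given immediate subtrees. -/
def mk (r : Rule) (ch : Fin r.arity → RuleTree) : RuleTree :=
  PFunctor.M.mk (F := RuleFunctor) ⟨r, ch⟩

/-- The `i`-th immediate subtree, with a default value for `i` out of range. -/
def kid (P : RuleTree) (i : ℕ) : RuleTree :=
  if h : i < P.root.arity then P.child ⟨i, h⟩ else P

theorem kid_eq (P : RuleTree) (i : ℕ) (h : i < P.root.arity) : P.kid i = P.child ⟨i, h⟩ := dif_pos h

theorem root_mk (r : Rule) (ch : Fin r.arity → RuleTree) : (mk r ch).root = r := by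
  exact congrArg Sigma.fst (PFunctor.M.dest_mk (F := RuleFunctor) ⟨r, ch⟩)

theorem kid_mk (r : Rule) (ch : Fin r.arity → RuleTree) (i : ℕ) (h : i < r.arity) :
    (mk r ch).kid i = ch ⟨i, h⟩ := by
  -- The type of the children depends on the root, so the sigma-equation is generalised before it is
  -- eliminated.
  have key : ∀ x : RuleFunctor RuleTree, x = ⟨r, ch⟩ →
      (if h : i < Rule.arity x.1 then x.2 ⟨i, h⟩ else mk r ch) = ch ⟨i, h⟩ := by
    rintro x rfl
    exact dif_pos h
  exact key _ (PFunctor.M.dest_mk (F := RuleFunctor) ⟨r, ch⟩)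

theorem toCoterm_eq_kid (P : RuleTree) :
    P.toCoterm = Coterm.apps (Coterm.step P.root)
      ((List.range P.root.arity).map fun i => (P.kid i).toCoterm) := by
  rw [toCoterm_eq]
  congr 1
  apply List.ext_getElem
  · simp
  · intro i h1 h2
    simp only [List.getElem_ofFn, List.getElem_map, List.getElem_range]
    rw [kid_eq]

theorem Sub.kid {P Q : RuleTree} (i : ℕ) (h : i < P.root.arity) (hs : Sub (P.kid i) Q) :
    Sub P Q := by
  rw [kid_eq P i h] at hs
  exact .step _ hs

theorem sub_iff {P Q : RuleTree} :
    Sub P Q ↔ Q = P ∨ ∃ i < P.root.arity, Sub (P.kid i) Q := by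
  constructor
  · rintro (_ | ⟨i, h⟩)
    · exact .inl rfl
    · exact .inr ⟨i, i.2, by rwa [kid_eq P i i.2]⟩
  · rintro (rfl | ⟨i, h, hs⟩)
    · exact .refl _
    · exact hs.kid i h

theorem isBranch_iff {P : RuleTree} {Q : ℕ → RuleTree} {b : ℕ → ℕ} :
    IsBranch P Q b ↔ Q 0 = P ∧ ∀ n, b n < (Q n).root.arity ∧ Q (n + 1) = (Q n).kid (b n) := by
  unfold IsBranch
  refine and_congr_right fun _ => forall_congr' fun n => ?_
  constructor
  · rintro ⟨h, e⟩
    exact ⟨h, by rw [e, kid_eq _ _ h]⟩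
  · rintro ⟨h, e⟩
    exact ⟨h, by rw [e, kid_eq _ _ h]⟩

theorem isCoderivation_iff {P : RuleTree} :
    P.IsCoderivation ↔ P.root.WellFormed ∧
      ∀ i < P.root.arity, P.root.prems[i]? = some (P.kid i).concl ∧ (P.kid i).IsCoderivation := by
  constructor
  · intro h
    refine ⟨(h P (.refl _)).1, fun i hi => ⟨?_, fun Q hQ => h Q (hQ.kid i hi)⟩⟩
    rw [kid_eq P i hi]
    exact (h P (.refl _)).2 ⟨i, hi⟩
  · rintro ⟨hw, h⟩ Q hQ
    rcases sub_iff.1 hQ with rfl | ⟨i, hi, hs⟩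
    · refine ⟨hw, fun i => ?_⟩
      rw [(h i i.2).1, kid_eq Q i i.2]
    · exact (h i hi).2 Q hs

theorem frequently_shift {p : ℕ → Prop} :
    (∃ᶠ n in Filter.atTop, p (n + 1)) ↔ ∃ᶠ n in Filter.atTop, p n := by
  conv_rhs => rw [← Filter.map_add_atTop_eq_nat 1, Filter.frequently_map]

theorem threadProgresses_shift {Q : ℕ → RuleTree} {θ : ℕ → Occ} :
    ThreadProgresses (fun n => Q (n + 1)) (fun n => θ (n + 1)) ↔ ThreadProgresses Q θ := by
  unfold ThreadProgresses
  have h1 : ∀ φ, (∃ᶠ n in Filter.atTop,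
      PrincipalAt (fun n => Q (n + 1)) (fun n => θ (n + 1)) φ n ∧ ∃ i, θ (n + 1) = .lhs i) ↔
      ∃ᶠ n in Filter.atTop, PrincipalAt Q θ φ n ∧ ∃ i, θ n = .lhs i := fun φ =>
    frequently_shift (p := fun n => PrincipalAt Q θ φ n ∧ ∃ i, θ n = .lhs i)
  have h2 : ∀ φ, (∃ᶠ n in Filter.atTop,
      PrincipalAt (fun n => Q (n + 1)) (fun n => θ (n + 1)) φ n) ↔
      ∃ᶠ n in Filter.atTop, PrincipalAt Q θ φ n := fun φ =>
    frequently_shift (p := fun n => PrincipalAt Q θ φ n)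
  simp only [h1, h2]

/-- A thread may start at any node and progress depends only on its tail, so one node can be added
to or removed from a branch. -/
theorem isProgressing_iff {P : RuleTree} :
    P.IsProgressing ↔ ∀ i < P.root.arity, (P.kid i).IsProgressing := by
  constructor
  · intro h i hi Q b hQ
    obtain ⟨hQ0, hQs⟩ := isBranch_iff.1 hQ
    obtain ⟨k, θ, hθ, hp⟩ := h (fun n => Nat.casesOn n P Q) (fun n => Nat.casesOn n i b)
      (isBranch_iff.2 ⟨rfl, fun n => by cases n with
        | zero => exact ⟨hi, hQ0⟩
        | succ n => exact hQs n⟩)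
    exact ⟨k, fun n => θ (n + 1), fun n hn => hθ (n + 1) (Nat.le_succ_of_le hn),
      threadProgresses_shift.2 hp⟩
  · intro h Q b hQ
    obtain ⟨hQ0, hQs⟩ := isBranch_iff.1 hQ
    subst hQ0
    obtain ⟨k, θ, hθ, hp⟩ := h (b 0) (hQs 0).1 (fun n => Q (n + 1)) (fun n => b (n + 1))
      (isBranch_iff.2 ⟨(hQs 0).2, fun n => hQs (n + 1)⟩)
    -- The junk value at `n = 0` is harmless, as the thread starts at `k + 1`.
    refine ⟨k + 1, fun n => θ (n - 1), fun n hn => ?_, threadProgresses_shift.1 ?_⟩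
    · obtain ⟨m, rfl⟩ : ∃ m, n = m + 1 := ⟨n - 1, by omega⟩
      exact hθ m (by omega)
    · exact hp

theorem isRegular_iff {P : RuleTree} :
    P.IsRegular ↔ ∀ i < P.root.arity, (P.kid i).IsRegular := by
  constructor
  · exact fun h i hi => Set.Finite.subset h fun Q hQ => hQ.kid i hi
  · intro h
    refine Set.Finite.subset ((Set.finite_singleton P).union
      (Set.Finite.biUnion (Set.finite_Iio P.root.arity) h)) fun Q hQ => ?_
    rcases sub_iff.1 hQ with rfl | ⟨i, hi, hs⟩
    · exact .inl rfl
    · exact .inr (Set.mem_biUnion (Set.mem_Iio.2 hi) hs)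

theorem isCMuLJ_iff {P : RuleTree} :
    P.IsCMuLJ ↔ P.root.WellFormed ∧
      ∀ i < P.root.arity, P.root.prems[i]? = some (P.kid i).concl ∧ (P.kid i).IsCMuLJ := by
  unfold IsCMuLJ
  rw [isCoderivation_iff, isRegular_iff, isProgressing_iff]
  grind

end RuleTree

/-! ### Numerals and projections as coderivations -/

open Coterm RuleTree

/-- `t` is (the coterm of) a `CμLJ⁻`-coderivation of `S`. -/
def Derives (S : Sequent) (t : Coterm) : Prop :=
  ∃ P : RuleTree, P.IsCMuLJ ∧ P.concl = S ∧ P.toCoterm = t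

theorem Derives.inClosure {S t} (h : Derives S t) : InClosure t := by
  obtain ⟨P, hP, -, rfl⟩ := h
  exact .base hP

/-- Steps with at most one premiss suffice here: only numerals and projections must be shown to lie
in the closure. -/
theorem Derives.step₀ {r : Rule} (hw : r.WellFormed) (hr : r.prems = []) :
    Derives r.concl (step r) := by
  have ha : r.arity = 0 := by simp [Rule.arity, hr]
  refine ⟨.mk r fun i => absurd i.2 (by omega), isCMuLJ_iff.2 ?_, ?_, ?_⟩
  · rw [root_mk]
    exact ⟨hw, fun i hi => by omega⟩
  · rw [RuleTree.concl, root_mk]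
  · rw [toCoterm_eq_kid, root_mk, show List.range r.arity = [] by rw [ha]; rfl]
    rfl

theorem Derives.step₁ {r : Rule} {S t} (hw : r.WellFormed) (hr : r.prems = [S])
    (h : Derives S t) : Derives r.concl (app (step r) t) := by
  obtain ⟨P, hP, rfl, rfl⟩ := h
  have ha : r.arity = 1 := by simp [Rule.arity, hr]
  refine ⟨.mk r fun _ => P, isCMuLJ_iff.2 ?_, ?_, ?_⟩
  · rw [root_mk]
    refine ⟨hw, fun i hi => ?_⟩
    rw [kid_mk r _ i hi]
    obtain rfl : i = 0 := by omega
    simp [hr, hP]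
  · rw [RuleTree.concl, root_mk]
  · rw [toCoterm_eq_kid, root_mk, show List.range r.arity = [0] by rw [ha]; rfl]
    simp only [List.map_cons, List.map_nil, apps, List.foldl]
    rw [kid_mk r _ 0 (by omega)]

theorem derives_numeral (n : ℕ) : Derives ⟨[], .nat⟩ (numeral n) := by
  induction n with
  | zero =>
    exact .step₀ (r := .natZero)
      (by simp [Rule.WellFormed, Rule.concl, Rule.prems, Ty.IsType]) rfl
  | succ n ih =>
    exact .step₁ (r := .natSucc []) (by simp [Rule.WellFormed, Rule.concl, Rule.prems, Ty.IsType])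
      rfl ih

theorem derives_id {σ : Ty} (hσ : σ.IsType) : Derives ⟨[σ], σ⟩ (step (.id σ)) :=
  .step₀ (r := .id σ) (by simp [Rule.WellFormed, Rule.concl, Rule.prems, hσ]) rfl

theorem derives_weak_id {σ τ : Ty} (hσ : σ.IsType) (hτ : τ.IsType) :
    Derives ⟨[σ, τ], σ⟩ (app (step (.weak [σ] τ σ)) (step (.id σ))) :=
  .step₁ (r := .weak [σ] τ σ) (by simp [Rule.WellFormed, Rule.concl, Rule.prems, hσ, hτ])
    rfl (derives_id hσ)

theorem derives_proj₀ {σ τ : Ty} (hσ : σ.IsType) (hτ : τ.IsType) :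
    Derives ⟨[.prod σ τ], σ⟩ (Coterm.proj₀ σ τ) :=
  .step₁ (r := .prodL [] σ τ σ)
    (by simp [Rule.WellFormed, Rule.concl, Rule.prems, Ty.IsType, hσ, hτ]) rfl
    (derives_weak_id hσ hτ)

theorem derives_proj₁ {σ τ : Ty} (hσ : σ.IsType) (hτ : τ.IsType) :
    Derives ⟨[.prod σ τ], τ⟩ (Coterm.proj₁ σ τ) :=
  .step₁ (r := .prodL [] σ τ τ)
    (by simp [Rule.WellFormed, Rule.concl, Rule.prems, Ty.IsType, hσ, hτ]) rfl
    (.step₁ (r := .exch [] σ τ [] τ)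
      (by simp [Rule.WellFormed, Rule.concl, Rule.prems, hσ, hτ]) rfl (derives_weak_id hτ hσ))

/-! ### Size of types -/

namespace Ty

/-- The number of constructors of a pretype. -/
def size : Ty → ℕ
  | var _ => 1
  | nat => 1
  | prod σ τ => size σ + size τ + 1
  | arr σ τ => size σ + size τ + 1
  | mu σ => size σ + 1

theorem size_rename (f : ℕ → ℕ) (σ : Ty) : (rename f σ).size = σ.size := by
  induction σ generalizing f <;> simp_all [rename, size]

theorem liftRen_comp (f g : ℕ → ℕ) : liftRen (f ∘ g) = liftRen f ∘ liftRen g := by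
  funext n
  cases n <;> rfl

theorem rename_rename (f g : ℕ → ℕ) (σ : Ty) : rename f (rename g σ) = rename (f ∘ g) σ := by
  induction σ generalizing f g <;> simp_all [rename, liftRen_comp]

theorem rename_liftRen_succ (f : ℕ → ℕ) (σ : Ty) :
    rename (liftRen f) (rename Nat.succ σ) = rename Nat.succ (rename f σ) := by
  rw [rename_rename, rename_rename]
  rfl

theorem liftRen_injective {f : ℕ → ℕ} (hf : f.Injective) : (liftRen f).Injective := by
  rintro (_ | m) (_ | n) h
  · rfl
  · simp [liftRen] at h
  · simp [liftRen] at h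
  · simp only [liftRen, Nat.add_right_cancel_iff] at h
    rw [hf h]

theorem rename_injective {f : ℕ → ℕ} (hf : f.Injective) : (rename f).Injective := by
  intro σ τ h
  induction σ generalizing f τ with
  | var n =>
    cases τ <;> simp_all [rename]
    exact hf h
  | nat => cases τ <;> simp_all [rename]
  | prod σ₁ σ₂ ih₁ ih₂ =>
    cases τ <;> simp_all [rename]
    exact ⟨ih₁ hf h.1, ih₂ hf h.2⟩
  | arr σ₁ σ₂ ih₁ ih₂ =>
    cases τ <;> simp_all [rename]
    exact ⟨ih₁ hf h.1, ih₂ hf h.2⟩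
  | mu σ ih =>
    cases τ <;> simp_all [rename]
    exact ih (liftRen_injective hf) h

/-- A small instance of a substitution contains none of the large substituted types, so that the
substitution can be undone by a renaming. -/
theorem rename_subst_of_size_lt {M : ℕ} {s : ℕ → Ty} {r : ℕ → ℕ}
    (hs : ∀ n, (∃ m, s n = var m ∧ n = r m) ∨ M ≤ (s n).size) {σ : Ty}
    (hσ : (subst s σ).size < M) : rename r (subst s σ) = σ := by
  induction σ generalizing s r with
  | var n =>
    rcases hs n with ⟨m, e, h⟩ | h
    · rw [subst, e, h]
      rfl
    · exact absurd hσ (not_lt.2 h)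
  | nat => rfl
  | prod σ τ ih₁ ih₂ =>
    simp only [subst, size] at hσ
    simp only [subst, rename]
    rw [ih₁ hs (by omega), ih₂ hs (by omega)]
  | arr σ τ ih₁ ih₂ =>
    simp only [subst, size] at hσ
    simp only [subst, rename]
    rw [ih₁ hs (by omega), ih₂ hs (by omega)]
  | mu σ ih =>
    simp only [subst, size] at hσ
    simp only [subst, rename]
    rw [ih (fun n => ?_) (by omega)]
    cases n with
    | zero => exact .inl ⟨0, rfl, rfl⟩
    | succ n =>
      rcases hs n with ⟨m, e, h⟩ | h
      · exact .inl ⟨m + 1, by simp [liftSub, e, rename], by simp [liftRen, h]⟩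
      · exact .inr (by simpa [liftSub, size_rename] using h)

/-- The descent uses the subformula order only through this consequence. -/
theorem Subformula.size_le {φ ψ : Ty} (h : Subformula φ ψ) : φ.size ≤ ψ.size := by
  induction h with
  | mu _ ih => rw [size_rename] at ih; simp only [size]; omega
  | refl _ => exact le_rfl
  | _ => simp only [size]; omega

end Ty

/-! ### Ordinal annotations and their descent under unfolding -/

/-- Pretypes whose least fixed points (and `N`) may be annotated by an ordinal, standing for an
approximant. -/
inductive ATy : Type 1
  | var (n : ℕ)
  | nat (o : Option Ordinal.{0})
  | prod (A B : ATy)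
  | arr (A B : ATy)
  | mu (o : Option Ordinal.{0}) (A : ATy)

namespace ATy

/-- The underlying pretype. -/
def erase : ATy → Ty
  | var n => .var n
  | nat _ => .nat
  | prod A B => .prod (erase A) (erase B)
  | arr A B => .arr (erase A) (erase B)
  | mu _ A => .mu (erase A)

/-- Renaming of free variables. -/
def rename : (ℕ → ℕ) → ATy → ATy
  | f, var n => var (f n)
  | _, nat o => nat o
  | f, prod A B => prod (rename f A) (rename f B)
  | f, arr A B => arr (rename f A) (rename f B)
  | f, mu o A => mu o (rename (Ty.liftRen f) A)

/-- Lifting of a substitution under a binder. -/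
def liftSub (s : ℕ → ATy) : ℕ → ATy
  | 0 => var 0
  | n + 1 => rename Nat.succ (s n)

/-- Simultaneous capture-avoiding substitution. -/
def subst : (ℕ → ATy) → ATy → ATy
  | s, var n => s n
  | _, nat o => nat o
  | s, prod A B => prod (subst s A) (subst s B)
  | s, arr A B => arr (subst s A) (subst s B)
  | s, mu o A => mu o (subst (liftSub s) A)

/-- The substitution of a single annotated type for the variable `0`. -/
def single (T : ATy) : ℕ → ATy
  | 0 => T
  | n + 1 => var n

/-- `inst A T` is `A(T)`: the variable `0` of `A` is replaced by `T`. -/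
def inst (A T : ATy) : ATy := subst (single T) A

theorem erase_rename (f : ℕ → ℕ) (A : ATy) : (rename f A).erase = Ty.rename f A.erase := by
  induction A generalizing f <;> simp_all [rename, erase, Ty.rename]

theorem erase_liftSub (s : ℕ → ATy) :
    (fun n => (liftSub s n).erase) = Ty.liftSub fun n => (s n).erase := by
  funext n
  cases n with
  | zero => rfl
  | succ n => exact erase_rename _ _

theorem erase_subst (s : ℕ → ATy) (A : ATy) :
    (subst s A).erase = Ty.subst (fun n => (s n).erase) A.erase := by
  induction A generalizing s <;> simp_all [subst, erase, Ty.subst, erase_liftSub]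

theorem erase_inst (A T : ATy) : (inst A T).erase = Ty.inst A.erase T.erase := by
  unfold inst Ty.inst
  rw [erase_subst]
  congr 1
  funext n
  cases n <;> rfl

/-- `Signed b A`: the annotated least fixed points in `A` are the positive ones if `b` is `true`, and
the negative ones if `b` is `false`. -/
def Signed : Bool → ATy → Prop
  | _, var _ => True
  | b, nat o => o.isSome = b
  | b, prod A B => Signed b A ∧ Signed b B
  | b, arr A B => Signed (!b) A ∧ Signed b B
  | b, mu o A => o.isSome = b ∧ Signed b A

theorem Signed.rename {b : Bool} {A : ATy} (h : Signed b A) (f : ℕ → ℕ) :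
    Signed b (A.rename f) := by
  induction A generalizing b f with
  | var n => trivial
  | nat o => exact h
  | prod A B ih₁ ih₂ => exact ⟨ih₁ h.1 f, ih₂ h.2 f⟩
  | arr A B ih₁ ih₂ => exact ⟨ih₁ h.1 f, ih₂ h.2 f⟩
  | mu o A ih => exact ⟨h.1, ih h.2 _⟩

/-- Each substituted type either has every sign, like a variable, or has sign `d` and replaces a
variable whose polarity turns `d` into `b`. -/
theorem Signed.subst {b d : Bool} {s : ℕ → ATy} {A : ATy} (h : Signed b A)
    (hs : ∀ n, (∀ c, Signed c (s n)) ∨ (Signed d (s n) ∧ Ty.Polar (b == d) n A.erase)) :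
    Signed b (A.subst s) := by
  induction A generalizing b s with
  | var n =>
    rcases hs n with h | ⟨h, e⟩
    · exact h b
    · rcases e with e | e
      · obtain rfl : b = d := by simpa using e
        exact h
      · exact absurd rfl e
  | nat o => exact h
  | prod A B ih₁ ih₂ =>
    exact ⟨ih₁ h.1 fun n => (hs n).imp_right fun h => ⟨h.1, h.2.1⟩,
      ih₂ h.2 fun n => (hs n).imp_right fun h => ⟨h.1, h.2.2⟩⟩
  | arr A B ih₁ ih₂ =>
    refine ⟨ih₁ h.1 fun n => (hs n).imp_right fun h => ⟨h.1, ?_⟩,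
      ih₂ h.2 fun n => (hs n).imp_right fun h => ⟨h.1, h.2.2⟩⟩
    -- `!(b == d)` and `(!b) == d` agree, but only after a case distinction.
    have := h.2.1
    cases b <;> cases d <;> exact this
  | mu o A ih =>
    refine ⟨h.1, ih h.2 fun n => ?_⟩
    cases n with
    | zero => exact .inl fun _ => trivial
    | succ n => exact (hs n).imp (fun h c => (h c).rename _) fun h => ⟨h.1.rename _, h.2⟩

/-- Positivity of the body of `μ` is what lets an unfolding keep its sign. -/
theorem Signed.inst {b : Bool} {A T : ATy} (hA : Signed b A) (hT : Signed b T)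
    (hp : Ty.Polar true 0 A.erase) : Signed b (A.inst T) := by
  refine Signed.subst (d := b) hA fun n => ?_
  cases n with
  | zero => exact .inr ⟨hT, by simpa using hp⟩
  | succ n => exact .inl fun _ => trivial

/-- The annotation of an unfolded fixed point decreases, if there is one. -/
inductive Drop : Option Ordinal.{0} → Option Ordinal.{0} → Prop
  | none : Drop none none
  | some {α β : Ordinal.{0}} : β < α → Drop (some α) (some β)

/-- Immediate descendants of an annotated type. -/
inductive Desc : ATy → ATy → Prop
  | prodLeft {A B} : Desc (prod A B) A
  | prodRight {A B} : Desc (prod A B) B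
  | arrLeft {A B} : Desc (arr A B) A
  | arrRight {A B} : Desc (arr A B) B
  | nat {o o'} : Drop o o' → Desc (nat o) (nat o')
  | mu {o o' A} : Drop o o' → Desc (mu o A) (inst A (mu o' A))

/-- Every copy of the fixed point `φ` in an annotated type is annotated by an ordinal of at
most `β`. -/
def Bounded : Ty → Ordinal.{0} → ATy → Prop
  | _, _, var _ => True
  | φ, β, nat o => φ = .nat → ∃ α ∈ o, α ≤ β
  | φ, β, prod A B => Bounded φ β A ∧ Bounded φ β B
  | φ, β, arr A B => Bounded φ β A ∧ Bounded φ β B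
  | φ, β, mu o A => (φ = .mu A.erase → ∃ α ∈ o, α ≤ β) ∧ Bounded (φ.rename Nat.succ) β A

/-- Injectivity ensures that copies of the renamed `φ` come only from copies of `φ`. -/
theorem Bounded.rename {φ : Ty} {β : Ordinal.{0}} {A : ATy} {f : ℕ → ℕ} (hf : f.Injective)
    (h : Bounded φ β A) : Bounded (φ.rename f) β (A.rename f) := by
  induction A generalizing φ f with
  | var n => trivial
  | nat o => exact fun e => h (Ty.rename_injective hf e)
  | prod A B ih₁ ih₂ => exact ⟨ih₁ hf h.1, ih₂ hf h.2⟩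
  | arr A B ih₁ ih₂ => exact ⟨ih₁ hf h.1, ih₂ hf h.2⟩
  | mu o A ih =>
    refine ⟨fun e => h.1 (Ty.rename_injective hf ?_), ?_⟩
    · rw [e, erase_rename]
      rfl
    · rw [← Ty.rename_liftRen_succ]
      exact ih (Ty.liftRen_injective hf) h.2

/-- A type smaller than `φ` contains no copy of it. -/
theorem Bounded.of_size_lt {φ : Ty} {β : Ordinal.{0}} {A : ATy} (h : A.erase.size < φ.size) :
    Bounded φ β A := by
  induction A generalizing φ with
  | var n => trivial
  | nat o =>
    rintro rfl
    exact absurd h (lt_irrefl _)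
  | prod A B ih₁ ih₂ =>
    simp only [erase, Ty.size] at h
    exact ⟨ih₁ (by omega), ih₂ (by omega)⟩
  | arr A B ih₁ ih₂ =>
    simp only [erase, Ty.size] at h
    exact ⟨ih₁ (by omega), ih₂ (by omega)⟩
  | mu o A ih =>
    refine ⟨?_, ih ?_⟩
    · rintro rfl
      exact absurd h (lt_irrefl _)
    · simp only [erase, Ty.size] at h
      rw [Ty.size_rename]
      omega

/-- A copy of `φ` in the result lies in a substituted type or comes from a fixed point of `A`. In
the second case its body is too small to contain a large substituted type, so the substitution there
is undone by `r` and the original fixed point was `φ.rename r`. -/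
theorem Bounded.subst {φ : Ty} {β : Ordinal.{0}} {s : ℕ → ATy} {r : ℕ → ℕ} {A : ATy}
    (hs : ∀ n, (∃ m, (s n).erase = .var m ∧ n = r m) ∨ φ.size ≤ (s n).erase.size)
    (hb : ∀ n, Bounded φ β (s n)) (hA : Bounded (φ.rename r) β A) : Bounded φ β (A.subst s) := by
  induction A generalizing φ s r with
  | var n => exact hb n
  | nat o =>
    rintro rfl
    exact hA rfl
  | prod A B ih₁ ih₂ => exact ⟨ih₁ hs hb hA.1, ih₂ hs hb hA.2⟩
  | arr A B ih₁ ih₂ => exact ⟨ih₁ hs hb hA.1, ih₂ hs hb hA.2⟩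
  | mu o A ih =>
    have hs' : ∀ n, (∃ m, (liftSub s n).erase = .var m ∧ n = Ty.liftRen r m) ∨
        φ.size ≤ (liftSub s n).erase.size := by
      rintro (_ | n)
      · exact .inl ⟨0, rfl, rfl⟩
      · rcases hs n with ⟨m, e, h⟩ | h
        · exact .inl ⟨m + 1, by simp [liftSub, erase_rename, e, Ty.rename], by simp [Ty.liftRen, h]⟩
        · exact .inr (by simpa [liftSub, erase_rename, Ty.size_rename] using h)
    refine ⟨fun e => hA.1 ?_, ih (r := Ty.liftRen r) ?_ ?_ ?_⟩
    · rw [e, Ty.rename, erase_subst, Ty.rename_subst_of_size_lt (M := φ.size) hs']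
      rw [e, Ty.size, erase_subst]
      omega
    · simpa only [Ty.size_rename] using hs'
    · rintro (_ | n)
      · trivial
      · exact (hb n).rename Nat.succ_injective
    · rw [Ty.rename_liftRen_succ]
      exact hA.2

theorem Bounded.inst {φ : Ty} {β : Ordinal.{0}} {A T : ATy} (hT : φ.size ≤ T.erase.size)
    (hb : Bounded φ β T) (hA : Bounded (φ.rename Nat.succ) β A) : Bounded φ β (A.inst T) := by
  refine Bounded.subst (r := Nat.succ) ?_ ?_ hA
  · rintro (_ | n)
    · exact .inr hT
    · exact .inl ⟨n, rfl, rfl⟩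
  · rintro (_ | n)
    · exact hb
    · trivial

/-- Along a step to a descendant of a type that contains the fixed point `φ`, the bound of the
annotations of `φ` does not increase. -/
theorem Bounded.desc {φ : Ty} {β : Ordinal.{0}} {A A' : ATy} (hφ : φ.size ≤ A.erase.size)
    (h : Bounded φ β A) (hd : Desc A A') (hne : A.erase ≠ φ) : Bounded φ β A' := by
  cases hd with
  | prodLeft => exact h.1
  | prodRight => exact h.2
  | arrLeft => exact h.1
  | arrRight => exact h.2
  | nat _ => exact fun e => absurd e.symm hne
  -- The unfolded fixed point is not `φ`, so its own annotation is irrelevant; the bound on its body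
  -- serves for the context and for the inserted copies.
  | mu _ => exact .inst hφ ⟨fun e => absurd e.symm hne, h.2⟩ h.2

/-- When the fixed point `φ` itself is unfolded, the bound decreases. -/
theorem Bounded.desc_self {φ : Ty} {β : Ordinal.{0}} {A A' : ATy} (hφ : φ.IsMu)
    (h : Bounded φ β A) (hd : Desc A A') (he : A.erase = φ) : ∃ β' < β, Bounded φ β' A' := by
  subst he
  cases hd with
  | prodLeft => exact hφ.elim
  | prodRight => exact hφ.elim
  | arrLeft => exact hφ.elim
  | arrRight => exact hφ.elim
  | nat hd =>
    -- A bounded copy carries an ordinal, which rules out an unfolding without annotation.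
    obtain ⟨α, hα, hle⟩ := h rfl
    cases hd with
    | none => cases hα
    | some hlt =>
      cases hα
      exact ⟨_, hlt.trans_le hle, fun _ => ⟨_, rfl, le_rfl⟩⟩
  | @mu o o' C hd =>
    obtain ⟨α, hα, hle⟩ := h.1 rfl
    cases hd with
    | none => cases hα
    | some hlt =>
      cases hα
      -- The body of `φ` is smaller than `φ`, so the only copies of `φ` in the unfolding are the
      -- inserted ones, all carrying the new ordinal.
      have hA : ∀ β, Bounded ((mu none C).erase.rename Nat.succ) β C := fun β =>
        .of_size_lt (by rw [Ty.size_rename]; exact Nat.lt_succ_self _)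
      exact ⟨_, hlt.trans_le hle, .inst le_rfl ⟨fun _ => ⟨_, rfl, le_rfl⟩, hA _⟩ (hA _)⟩

/-- Starting point of the descent: a left-hand fixed point is annotated at its root, and its body is
too small to contain another copy. -/
theorem Signed.bounded_self {A : ATy} (h : Signed true A) (hA : A.erase.IsMu) :
    ∃ β, Bounded A.erase β A := by
  cases A with
  | nat o =>
    obtain ⟨α, rfl⟩ := Option.isSome_iff_exists.1 h
    exact ⟨α, fun _ => ⟨α, rfl, le_rfl⟩⟩
  | mu o A =>
    obtain ⟨α, rfl⟩ := Option.isSome_iff_exists.1 h.1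
    exact ⟨α, fun _ => ⟨α, rfl, le_rfl⟩,
      .of_size_lt (by rw [Ty.size_rename]; exact Nat.lt_succ_self _)⟩
  | _ => exact hA.elim

end ATy

/-! ### Candidates -/

theorem isCandidate_inClosure : IsCandidate {t | InClosure t} :=
  ⟨fun _ h => h, fun _ _ _ h _ => h⟩

theorem IsCandidate.extend {X : Set Coterm} {ρ : ℕ → Set Coterm} (hX : IsCandidate X)
    (hρ : ∀ n, IsCandidate (ρ n)) : ∀ n, IsCandidate (extend X ρ n)
  | 0 => hX
  | n + 1 => hρ n

/-- The empty intersection would contain coterms outside the closure. -/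
theorem IsCandidate.sInter {S : Set (Set Coterm)} (hS : ∀ A ∈ S, IsCandidate A)
    (hne : S.Nonempty) : IsCandidate (⋂₀ S) := by
  obtain ⟨A, hA⟩ := hne
  exact ⟨fun t ht => (hS A hA).1 t (ht A hA),
    fun t ht t' ht' hc B hB => (hS B hB).2 t (ht B hB) t' ht' hc⟩

/-- Conversion passes under the projections, which themselves lie in the closure because their
annotations are types. -/
theorem IsCandidate.prod {A B : Set Coterm} (hA : IsCandidate A) (hB : IsCandidate B) :
    IsCandidate {t | InClosure t ∧ ∀ σ' τ' : Ty, σ'.IsType → τ'.IsType →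
      app (Coterm.proj₀ σ' τ') t ∈ A ∧ app (Coterm.proj₁ σ' τ') t ∈ B} := by
  refine ⟨fun t ht => ht.1, fun t ht t' ht' hc => ⟨ht', fun σ τ hσ hτ => ?_⟩⟩
  exact ⟨hA.2 _ (ht.2 σ τ hσ hτ).1 _ (.app (derives_proj₀ hσ hτ).inClosure ht')
      (.app (.refl _) hc),
    hB.2 _ (ht.2 σ τ hσ hτ).2 _ (.app (derives_proj₁ hσ hτ).inClosure ht') (.app (.refl _) hc)⟩

theorem IsCandidate.arr {A B : Set Coterm} (hA : IsCandidate A) (hB : IsCandidate B) :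
    IsCandidate {t | InClosure t ∧ ∀ s ∈ A, app t s ∈ B} :=
  ⟨fun _ ht => ht.1, fun _ ht _ ht' hc => ⟨ht', fun s hs =>
    hB.2 _ (ht.2 s hs) _ (.app ht' (hA.1 s hs)) (.app hc (.refl _))⟩⟩

/-- The approximants, from below, of the least fixed point of `f`. -/
def approx (f : Set Coterm → Set Coterm) (α : Ordinal.{0}) : Set Coterm :=
  {t | ∃ β, ∃ _ : β < α, t ∈ f (approx f β)}
termination_by α

theorem mem_approx {f : Set Coterm → Set Coterm} {α : Ordinal.{0}} {t : Coterm} :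
    t ∈ approx f α ↔ ∃ β < α, t ∈ f (approx f β) := by
  rw [approx]
  simp

/-- Closure under conversion concerns one element at a time, so it passes to unions, including the
empty one at stage `0`. -/
theorem IsCandidate.approx {f : Set Coterm → Set Coterm}
    (hf : ∀ X, IsCandidate X → IsCandidate (f X)) (α : Ordinal.{0}) :
    IsCandidate (approx f α) := by
  induction α using WellFoundedLT.induction with
  | ind α ih =>
    refine ⟨fun t ht => ?_, fun t ht t' ht' hc => ?_⟩
    · obtain ⟨β, hβ, h⟩ := mem_approx.1 ht
      exact (hf _ (ih β hβ)).1 t h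
    · obtain ⟨β, hβ, h⟩ := mem_approx.1 ht
      exact mem_approx.2 ⟨β, hβ, (hf _ (ih β hβ)).2 t h t' ht' hc⟩

/-- The approximants of monotone maps are stationary from here on. -/
noncomputable def closureOrdinal : Ordinal.{0} := (Order.succ (Cardinal.mk (Set Coterm))).ord

/-- The base point `⊥` is the empty set and adds nothing to the unions. -/
theorem approx_eq_lfpApprox (f : Set Coterm →o Set Coterm) (α : Ordinal.{0}) :
    approx f α = OrdinalApprox.lfpApprox f ⊥ α := by
  induction α using WellFoundedLT.induction with
  | ind α ih =>
    rw [OrdinalApprox.lfpApprox]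
    ext t
    simp only [mem_approx, Set.bot_eq_empty, Set.sup_eq_union, Set.empty_union, Set.iSup_eq_iUnion,
      Set.mem_iUnion, exists_prop]
    exact exists_congr fun β => and_congr_right fun hβ => by rw [ih β hβ]; rfl

/-- The stages form an increasing chain of sets of coterms, which is stationary by the successor of
the number of such sets. -/
theorem approx_closureOrdinal {f : Set Coterm → Set Coterm} (hf : Monotone f) :
    f (approx f closureOrdinal) = approx f closureOrdinal := by
  have h := approx_eq_lfpApprox ⟨f, hf⟩ closureOrdinal
  rw [closureOrdinal, OrdinalApprox.lfpApprox_ord_eq_lfp] at h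
  simp only [OrderHom.coe_mk] at h
  rw [closureOrdinal, h]
  exact OrderHom.map_lfp ⟨f, hf⟩

/-! ### Interpretation of annotated types -/

/-- The interpretation of annotated types, by approximants in place of annotated fixed points. -/
def interpA : ATy → (ℕ → Set Coterm) → Set Coterm
  | .var n, ρ => ρ n
  | .nat o, _ => {t | InClosure t ∧ ∃ n : ℕ, (∀ α ∈ o, (n : Ordinal.{0}) < α) ∧ Conv t (numeral n)}
  | .prod A B, ρ => {t | InClosure t ∧ ∀ σ' τ' : Ty, σ'.IsType → τ'.IsType →
      app (Coterm.proj₀ σ' τ') t ∈ interpA A ρ ∧ app (Coterm.proj₁ σ' τ') t ∈ interpA B ρ}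
  | .arr A B, ρ => {t | InClosure t ∧ ∀ s ∈ interpA A ρ, app t s ∈ interpA B ρ}
  | .mu none A, ρ => ⋂₀ {X | IsCandidate X ∧ interpA A (extend X ρ) ⊆ X}
  | .mu (some α) A, ρ => approx (fun X => interpA A (extend X ρ)) α

theorem extend_comp_liftRen (X : Set Coterm) (ρ : ℕ → Set Coterm) (f : ℕ → ℕ) :
    extend X ρ ∘ Ty.liftRen f = extend X (ρ ∘ f) := by
  funext n
  cases n <;> rfl

theorem interpA_rename (f : ℕ → ℕ) (A : ATy) (ρ : ℕ → Set Coterm) :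
    interpA (A.rename f) ρ = interpA A (ρ ∘ f) := by
  induction A generalizing f ρ with
  | var n => rfl
  | nat o => rfl
  | prod A B ih₁ ih₂ => simp only [ATy.rename, interpA, ih₁, ih₂]
  | arr A B ih₁ ih₂ => simp only [ATy.rename, interpA, ih₁, ih₂]
  | mu o A ih => cases o <;> simp only [ATy.rename, interpA, ih, extend_comp_liftRen]

theorem interpA_liftSub (s : ℕ → ATy) (X : Set Coterm) (ρ : ℕ → Set Coterm) :
    (fun n => interpA (ATy.liftSub s n) (extend X ρ)) = extend X fun n => interpA (s n) ρ := by
  funext n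
  cases n with
  | zero => rfl
  | succ n => exact interpA_rename _ _ _

theorem interpA_subst (s : ℕ → ATy) (A : ATy) (ρ : ℕ → Set Coterm) :
    interpA (A.subst s) ρ = interpA A fun n => interpA (s n) ρ := by
  induction A generalizing s ρ with
  | var n => rfl
  | nat o => rfl
  | prod A B ih₁ ih₂ => simp only [ATy.subst, interpA, ih₁, ih₂]
  | arr A B ih₁ ih₂ => simp only [ATy.subst, interpA, ih₁, ih₂]
  | mu o A ih => cases o <;> simp only [ATy.subst, interpA, ih, interpA_liftSub]

theorem interpA_inst (A T : ATy) (ρ : ℕ → Set Coterm) :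
    interpA (A.inst T) ρ = interpA A (extend (interpA T ρ) ρ) := by
  unfold ATy.inst
  rw [interpA_subst]
  congr 1
  funext n
  cases n <;> rfl

theorem isCandidate_interpA (A : ATy) {ρ : ℕ → Set Coterm} (hρ : ∀ n, IsCandidate (ρ n)) :
    IsCandidate (interpA A ρ) := by
  induction A generalizing ρ with
  | var n => exact hρ n
  | nat o =>
    refine ⟨fun t ht => ht.1, ?_⟩
    rintro t ⟨-, n, hn, h⟩ t' ht' hc
    exact ⟨ht', n, hn, hc.symm.trans h⟩
  | prod A B ih₁ ih₂ => exact (ih₁ hρ).prod (ih₂ hρ)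
  | arr A B ih₁ ih₂ => exact (ih₁ hρ).arr (ih₂ hρ)
  | mu o A ih =>
    cases o with
    | none =>
      exact .sInter (fun _ hX => hX.1) ⟨_, isCandidate_inClosure,
        (ih (isCandidate_inClosure.extend hρ)).1⟩
    | some α => exact .approx (fun X hX => ih (hX.extend hρ)) α

theorem approx_mono {f g : Set Coterm → Set Coterm} (hf : Monotone f) (h : ∀ X, f X ⊆ g X)
    (α : Ordinal.{0}) : approx f α ⊆ approx g α := by
  induction α using WellFoundedLT.induction with
  | ind α ih =>
    intro t ht
    obtain ⟨β, hβ, h'⟩ := mem_approx.1 ht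
    exact mem_approx.2 ⟨β, hβ, h _ (hf (ih β hβ) h')⟩

/-- Interpretations are monotone in the positive variables and antitone in the negative ones. -/
theorem interpA_polar (A : ATy) (hA : A.erase.IsType) {k : ℕ} {ρ ρ' : ℕ → Set Coterm}
    (hne : ∀ n, n ≠ k → ρ n = ρ' n) (hk : ρ k ⊆ ρ' k) :
    (Ty.Polar true k A.erase → interpA A ρ ⊆ interpA A ρ') ∧
      (Ty.Polar false k A.erase → interpA A ρ' ⊆ interpA A ρ) := by
  induction A generalizing k ρ ρ' with
  | var n =>
    constructor
    · intro _
      by_cases h : n = k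
      · subst h
        exact hk
      · exact (hne n h).le
    · intro h
      exact (hne n (h.resolve_left (by decide))).ge
  | nat o => exact ⟨fun _ => le_rfl, fun _ => le_rfl⟩
  | prod A B ih₁ ih₂ =>
    have h₁ := ih₁ hA.1 hne hk
    have h₂ := ih₂ hA.2 hne hk
    exact ⟨fun hp t ht => ⟨ht.1, fun σ τ hσ hτ =>
        ⟨h₁.1 hp.1 (ht.2 σ τ hσ hτ).1, h₂.1 hp.2 (ht.2 σ τ hσ hτ).2⟩⟩,
      fun hp t ht => ⟨ht.1, fun σ τ hσ hτ =>
        ⟨h₁.2 hp.1 (ht.2 σ τ hσ hτ).1, h₂.2 hp.2 (ht.2 σ τ hσ hτ).2⟩⟩⟩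
  | arr A B ih₁ ih₂ =>
    have h₁ := ih₁ hA.1 hne hk
    have h₂ := ih₂ hA.2 hne hk
    exact ⟨fun hp t ht => ⟨ht.1, fun s hs => h₂.1 hp.2 (ht.2 s (h₁.2 hp.1 hs))⟩,
      fun hp t ht => ⟨ht.1, fun s hs => h₂.2 hp.2 (ht.2 s (h₁.1 hp.1 hs))⟩⟩
  | mu o A ih =>
    have h := fun X : Set Coterm => ih hA.2 (k := k + 1) (ρ := extend X ρ) (ρ' := extend X ρ')
      (fun n hn => by
        cases n with
        | zero => rfl
        | succ n => exact hne n (by simpa using hn)) hk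
    -- The induction hypothesis at the bound variable, which is positive; the comparison of
    -- approximants needs it.
    have hm : ∀ ρ, Monotone fun X => interpA A (extend X ρ) := fun ρ X Y hXY =>
      (ih hA.2 (k := 0) (ρ := extend X ρ) (ρ' := extend Y ρ)
        (fun n hn => by
          cases n with
          | zero => exact absurd rfl hn
          | succ n => rfl) hXY).1 hA.1
    cases o with
    | none =>
      exact ⟨fun hp => Set.sInter_subset_sInter fun X hX => ⟨hX.1, ((h X).1 hp).trans hX.2⟩,
        fun hp => Set.sInter_subset_sInter fun X hX => ⟨hX.1, ((h X).2 hp).trans hX.2⟩⟩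
    | some α =>
      exact ⟨fun hp => approx_mono (hm ρ) (fun X => (h X).1 hp) α,
        fun hp => approx_mono (hm ρ') (fun X => (h X).2 hp) α⟩

theorem interpA_monotone {A : ATy} (hA : A.erase.IsType) (hp : Ty.Polar true 0 A.erase)
    (ρ : ℕ → Set Coterm) : Monotone fun X => interpA A (extend X ρ) := fun X Y hXY =>
  (interpA_polar A hA (k := 0) (ρ := extend X ρ) (ρ' := extend Y ρ)
    (fun n hn => by
      cases n with
      | zero => exact absurd rfl hn
      | succ n => rfl) hXY).1 hp

/-- The least fixed point is closed under the operator. -/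
theorem interpA_mu_closed {A : ATy} (hA : A.erase.IsType) (hp : Ty.Polar true 0 A.erase)
    (ρ : ℕ → Set Coterm) :
    interpA A (extend (interpA (.mu none A) ρ) ρ) ⊆ interpA (.mu none A) ρ :=
  Set.subset_sInter fun _ hX =>
    (interpA_monotone hA hp ρ (Set.sInter_subset_of_mem hX)).trans hX.2

/-! ### Comparison of plain and annotated types -/

namespace Ty

/-- A pretype without annotations. -/
def plain : Ty → ATy
  | var n => .var n
  | nat => .nat none
  | prod σ τ => .prod (plain σ) (plain τ)
  | arr σ τ => .arr (plain σ) (plain τ)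
  | mu σ => .mu none (plain σ)

/-- A pretype with all fixed points of sign `b` annotated by their closure ordinals. -/
noncomputable def annot (b : Bool) : Ty → ATy
  | var n => .var n
  | nat => .nat (if b then some Ordinal.omega0 else none)
  | prod σ τ => .prod (annot b σ) (annot b τ)
  | arr σ τ => .arr (annot (!b) σ) (annot b τ)
  | mu σ => .mu (if b then some closureOrdinal else none) (annot b σ)

theorem erase_plain (σ : Ty) : σ.plain.erase = σ := by
  induction σ <;> simp_all [plain, ATy.erase]

theorem erase_annot (b : Bool) (σ : Ty) : (σ.annot b).erase = σ := by
  induction σ generalizing b <;> simp_all only [annot, ATy.erase]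

theorem signed_annot (b : Bool) (σ : Ty) : (σ.annot b).Signed b := by
  induction σ generalizing b with
  | var n => trivial
  | nat => cases b <;> rfl
  | prod σ τ ih₁ ih₂ => exact ⟨ih₁ b, ih₂ b⟩
  | arr σ τ ih₁ ih₂ => exact ⟨ih₁ _, ih₂ b⟩
  | mu σ ih => exact ⟨by cases b <;> rfl, ih b⟩

end Ty

theorem interpA_plain (σ : Ty) (ρ : ℕ → Set Coterm) : interpA σ.plain ρ = interp σ ρ := by
  induction σ generalizing ρ <;> simp_all [Ty.plain, interpA, interp]

theorem isCandidate_interp (σ : Ty) {ρ : ℕ → Set Coterm} (hρ : ∀ n, IsCandidate (ρ n)) :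
    IsCandidate (interp σ ρ) :=
  interpA_plain σ ρ ▸ isCandidate_interpA _ hρ

theorem interp_monotone {σ : Ty} (hσ : (Ty.mu σ).IsType) (ρ : ℕ → Set Coterm) :
    Monotone fun X => interp σ (extend X ρ) := by
  simp only [← interpA_plain]
  exact interpA_monotone (by rw [Ty.erase_plain]; exact hσ.2) (by rw [Ty.erase_plain]; exact hσ.1) ρ

theorem interp_mu_closed {σ : Ty} (hσ : (Ty.mu σ).IsType) (ρ : ℕ → Set Coterm) :
    interp σ (extend (interp (.mu σ) ρ) ρ) ⊆ interp (.mu σ) ρ :=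
  Set.subset_sInter fun _ hX =>
    (interp_monotone hσ ρ (Set.sInter_subset_of_mem hX)).trans hX.2

/-- Annotations shrink the interpretation when positive, and enlarge it when negative. -/
theorem interpA_sound {A : ATy} (hA : A.erase.IsType) {b : Bool} (hb : A.Signed b)
    (ρ : ℕ → Set Coterm) :
    (b = true → interpA A ρ ⊆ interp A.erase ρ) ∧ (b = false → interp A.erase ρ ⊆ interpA A ρ) := by
  induction A generalizing b ρ with
  | var n => exact ⟨fun _ => le_rfl, fun _ => le_rfl⟩
  | nat o =>
    constructor
    · rintro - t ⟨h, n, -, hn⟩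
      exact ⟨h, n, hn⟩
    · rintro rfl t ⟨h, n, hn⟩
      obtain rfl : o = none := Option.isNone_iff_eq_none.1 (by simpa [ATy.Signed] using hb)
      exact ⟨h, n, by simp, hn⟩
  | prod A B ih₁ ih₂ =>
    have h₁ := ih₁ hA.1 hb.1 ρ
    have h₂ := ih₂ hA.2 hb.2 ρ
    exact ⟨fun hp t ht => ⟨ht.1, fun σ τ hσ hτ =>
        ⟨h₁.1 hp (ht.2 σ τ hσ hτ).1, h₂.1 hp (ht.2 σ τ hσ hτ).2⟩⟩,
      fun hp t ht => ⟨ht.1, fun σ τ hσ hτ =>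
        ⟨h₁.2 hp (ht.2 σ τ hσ hτ).1, h₂.2 hp (ht.2 σ τ hσ hτ).2⟩⟩⟩
  | arr A B ih₁ ih₂ =>
    have h₁ := ih₁ hA.1 hb.1 ρ
    have h₂ := ih₂ hA.2 hb.2 ρ
    exact ⟨fun hp t ht => ⟨ht.1, fun s hs => h₂.1 hp (ht.2 s (h₁.2 (by simp [hp]) hs))⟩,
      fun hp t ht => ⟨ht.1, fun s hs => h₂.2 hp (ht.2 s (h₁.1 (by simp [hp]) hs))⟩⟩
  | mu o A ih =>
    have h := fun X : Set Coterm => ih hA.2 hb.2 (extend X ρ)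
    cases o with
    | none =>
      refine ⟨?_, fun hp => Set.sInter_subset_sInter fun X hX => ⟨hX.1, ((h X).2 hp).trans hX.2⟩⟩
      rintro rfl
      exact absurd hb.1 (by simp)
    | some α =>
      refine ⟨fun hp => ?_, ?_⟩
      -- Every stage lies below the least fixed point, since that is closed under the larger,
      -- monotone operator.
      · have key : ∀ α, approx (fun X => interpA A (extend X ρ)) α ⊆ interp (.mu A.erase) ρ := by
          intro α
          induction α using WellFoundedLT.induction with
          | ind α ih' =>
            intro t ht
            obtain ⟨β, hβ, h'⟩ := mem_approx.1 ht
            exact interp_mu_closed hA ρ (interp_monotone hA ρ (ih' β hβ) ((h _).1 hp h'))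
        exact key α
      · rintro rfl
        exact absurd hb.1 (by simp)

/-- Annotation by closure ordinals does not change the interpretation. -/
theorem interp_annot {σ : Ty} (hσ : σ.IsType) {ρ : ℕ → Set Coterm} (hρ : ∀ n, IsCandidate (ρ n)) :
    interp σ ρ ⊆ interpA (σ.annot true) ρ ∧ interpA (σ.annot false) ρ ⊆ interp σ ρ := by
  induction σ generalizing ρ with
  | var n => exact ⟨le_rfl, le_rfl⟩
  | nat =>
    constructor
    · rintro t ⟨h, n, hn⟩
      refine ⟨h, n, ?_, hn⟩
      rintro α hα
      obtain rfl : Ordinal.omega0 = α := by simpa using hα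
      exact Ordinal.natCast_lt_omega0 n
    · rintro t ⟨h, n, -, hn⟩
      exact ⟨h, n, hn⟩
  | prod σ τ ih₁ ih₂ =>
    have h₁ := ih₁ hσ.1 hρ
    have h₂ := ih₂ hσ.2 hρ
    exact ⟨fun t ht => ⟨ht.1, fun σ τ hσ hτ =>
        ⟨h₁.1 (ht.2 σ τ hσ hτ).1, h₂.1 (ht.2 σ τ hσ hτ).2⟩⟩,
      fun t ht => ⟨ht.1, fun σ τ hσ hτ =>
        ⟨h₁.2 (ht.2 σ τ hσ hτ).1, h₂.2 (ht.2 σ τ hσ hτ).2⟩⟩⟩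
  | arr σ τ ih₁ ih₂ =>
    have h₁ := ih₁ hσ.1 hρ
    have h₂ := ih₂ hσ.2 hρ
    exact ⟨fun t ht => ⟨ht.1, fun s hs => h₂.1 (ht.2 s (h₁.2 hs))⟩,
      fun t ht => ⟨ht.1, fun s hs => h₂.2 (ht.2 s (h₁.1 hs))⟩⟩
  | mu σ ih =>
    have h := fun X (hX : IsCandidate X) => ih hσ.2 (hX.extend hρ)
    constructor
    -- The stage at the closure ordinal is a fixed point and a candidate, hence one of the sets
    -- intersected in the interpretation of the `μ`-type; the induction hypothesis is available only
    -- at candidates.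
    · have hfix := approx_closureOrdinal (interpA_monotone (A := σ.annot true)
        (by rw [Ty.erase_annot]; exact hσ.2) (by rw [Ty.erase_annot]; exact hσ.1) ρ)
      have hc := IsCandidate.approx (f := fun X => interpA (σ.annot true) (extend X ρ))
        (fun X hX => isCandidate_interpA _ (hX.extend hρ)) closureOrdinal
      exact Set.sInter_subset_of_mem ⟨hc, ((h _ hc).1).trans hfix.le⟩
    · exact Set.sInter_subset_sInter fun X hX => ⟨hX.1, ((h X hX.1).2).trans hX.2⟩

/-! ### Local soundness of the rules -/

theorem apps_append (t : Coterm) (xs ys : List Coterm) :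
    apps t (xs ++ ys) = apps (apps t xs) ys := List.foldl_append

theorem inClosure_apps {t : Coterm} {xs : List Coterm} (ht : InClosure t)
    (hxs : ∀ x ∈ xs, InClosure x) : InClosure (apps t xs) := by
  induction xs generalizing t with
  | nil => exact ht
  | cons x xs ih =>
    exact ih (.app ht (hxs x (by simp))) fun y hy => hxs y (by simp [hy])

theorem IsCandidate.notMem_of_conv {X : Set Coterm} (hX : IsCandidate X) {t t' : Coterm}
    (h : t ∉ X) (ht : InClosure t) (hc : Conv t t') : t' ∉ X := fun h' =>
  h (hX.2 _ h' _ ht hc.symm)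

/-- The annotated type at an occurrence, in an annotated sequent with inputs. -/
def annotAt (ps : List (Coterm × ATy)) (B : ATy) : Occ → Option ATy
  | .lhs i => ps[i]?.map Prod.snd
  | .rhs => some B

/-- The inputs `ps` refute that `t` inhabits the sequent `S`, annotated by ordinals. -/
structure Refutes (ρ : ℕ → Set Coterm) (S : Sequent) (t : Coterm) (ps : List (Coterm × ATy))
    (B : ATy) : Prop where
  ant : ps.map (fun p => p.2.erase) = S.ant
  suc : B.erase = S.suc
  inputs : ∀ p ∈ ps, p.1 ∈ interpA p.2 ρ ∧ p.2.Signed true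
  signed : B.Signed false
  out : apps t (ps.map Prod.fst) ∉ interpA B ρ

/-- The annotated types follow the ancestry in premiss number `j` of `r`. -/
def Traces (r : Rule) (j : ℕ) (f g : Occ → Option ATy) : Prop :=
  ∀ p q, Ancestor r j p q → ∀ A, f p = some A →
    ∃ A', g q = some A' ∧
      (r.principal = some p → ATy.Desc A A') ∧
      (r.principal ≠ some p → A' = A)

/-- Some premiss of `r`, inhabited by the respective member of `ts`, is refuted. -/
def RefutesPremiss (ρ : ℕ → Set Coterm) (r : Rule) (ts : List Coterm) (ps : List (Coterm × ATy))
    (B : ATy) : Prop :=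
  ∃ j S t ps' B', r.prems[j]? = some S ∧ ts[j]? = some t ∧ Refutes ρ S t ps' B' ∧
    Traces r j (annotAt ps B) (annotAt ps' B')

theorem Refutes.inClosure_input {ρ : ℕ → Set Coterm} {S t ps B} (h : Refutes ρ S t ps B)
    (hρ : ∀ n, IsCandidate (ρ n)) {p : Coterm × ATy} (hp : p ∈ ps) : InClosure p.1 :=
  (isCandidate_interpA _ hρ).1 _ (h.inputs p hp).1

theorem Refutes.inClosure_apps {ρ : ℕ → Set Coterm} {S t ps B} (h : Refutes ρ S t ps B)
    (hρ : ∀ n, IsCandidate (ρ n)) (ht : InClosure t) : InClosure (apps t (ps.map Prod.fst)) := by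
  refine MuLJ.inClosure_apps ht fun x hx => ?_
  obtain ⟨p, hp, rfl⟩ := List.mem_map.1 hx
  exact h.inClosure_input hρ hp

/-- Only the original application must lie in the closure: membership of `u` would transfer back to
it. -/
theorem Refutes.out_of_conv {ρ : ℕ → Set Coterm} {S t ps B} (h : Refutes ρ S t ps B)
    (hρ : ∀ n, IsCandidate (ρ n)) (ht : InClosure t) {u : Coterm}
    (hu : Conv (apps t (ps.map Prod.fst)) u) : u ∉ interpA B ρ :=
  (isCandidate_interpA _ hρ).notMem_of_conv h.out (h.inClosure_apps hρ ht) hu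

/-- The equations absorb the regrouping of argument lists needed to match a reduction clause. -/
theorem conv_of_red {s s' t t' : Coterm} (h : Red s' t') (hs : s = s') (ht : t' = t) :
    Conv s t := hs ▸ ht ▸ .red h

section Rules

variable {ρ : ℕ → Set Coterm} {Γ Δ : List Ty} {σ τ γ : Ty} {s t : Coterm}
  {ps : List (Coterm × ATy)} {B : ATy}

/-- Left annotations shrink the interpretation of `σ` and right ones enlarge it, so the input
already lies in the output type. -/
theorem not_refutes_id (hρ : ∀ n, IsCandidate (ρ n)) (hσ : σ.IsType)
    (hc : InClosure (step (.id σ)))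
    (h : Refutes ρ (Rule.id σ).concl (step (.id σ)) ps B) : False := by
  obtain ⟨p, rfl, hp⟩ := by simpa only [Rule.concl, List.map_eq_singleton_iff] using h.ant
  have hin := h.inputs p (by simp)
  have hB : B.erase = σ := h.suc
  refine h.out_of_conv hρ hc (.red (.id p.1)) ?_
  subst hp
  have h₁ := (interpA_sound hσ hin.2 ρ).1 rfl hin.1
  rw [← hB] at h₁ hσ
  exact (interpA_sound hσ h.signed ρ).2 rfl h₁

theorem refutesPremiss_exch (hρ : ∀ n, IsCandidate (ρ n))
    (hc : InClosure (apps (step (.exch Γ τ σ Δ γ)) [t]))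
    (h : Refutes ρ (Rule.exch Γ τ σ Δ γ).concl (apps (step (.exch Γ τ σ Δ γ)) [t]) ps B) :
    RefutesPremiss ρ (.exch Γ τ σ Δ γ) [t] ps B := by
  obtain ⟨_, ps₂, rfl, ⟨ps₁, _, rfl, hΓ, p, _, rfl, hp, q, _, rfl, hq, rfl⟩, hΔ⟩ := by
    simpa only [Rule.concl, List.map_eq_append_iff, List.map_eq_cons_iff, List.map_eq_nil_iff]
      using h.ant
  have hΓ' : Γ.length = ps₁.length := by simp [← hΓ]
  have hΔ' : Δ.length = ps₂.length := by simp [← hΔ]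
  refine ⟨0, _, t, ps₁ ++ [q, p] ++ ps₂, B, rfl, rfl,
    ⟨by simp [hΓ, hΔ, hp, hq], h.suc, fun x hx => h.inputs x (by simp at hx ⊢; tauto), h.signed,
      h.out_of_conv hρ hc (conv_of_red (.exch (Γ := Γ) (τ := τ) (σ := σ) (Δ := Δ) (γ := γ) t p.1 q.1 (ps₁.map Prod.fst) (ps₂.map Prod.fst)
        (by simp [hΓ']) (by simp [hΔ'])) (by simp [← apps_append]) (by simp))⟩, ?_⟩
  clear h hc
  rintro _ _ (_ | _) A hA <;> grind [annotAt, Rule.principal]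

theorem refutesPremiss_weak (hρ : ∀ n, IsCandidate (ρ n))
    (hc : InClosure (apps (step (.weak Γ σ τ)) [t]))
    (h : Refutes ρ (Rule.weak Γ σ τ).concl (apps (step (.weak Γ σ τ)) [t]) ps B) :
    RefutesPremiss ρ (.weak Γ σ τ) [t] ps B := by
  obtain ⟨ps₁, _, rfl, hΓ, p, rfl, hp⟩ := by
    simpa only [Rule.concl, List.map_eq_append_iff, List.map_eq_singleton_iff] using h.ant
  have hΓ' : Γ.length = ps₁.length := by simp [← hΓ]
  refine ⟨0, _, t, ps₁, B, rfl, rfl,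
    ⟨by simp [hΓ], h.suc, fun x hx => h.inputs x (by simp [hx]), h.signed,
      h.out_of_conv hρ hc (conv_of_red (.weak (Γ := Γ) (σ := σ) (τ := τ) t p.1 (ps₁.map Prod.fst)
        (by simp [hΓ'])) (by simp [← apps_append]) rfl)⟩, ?_⟩
  clear h hc
  rintro _ _ (_ | _) A hA <;> grind [annotAt, Rule.principal]

/-- Both copies inherit the same annotated type, so a thread may follow either. -/
theorem refutesPremiss_contr (hρ : ∀ n, IsCandidate (ρ n))
    (hc : InClosure (apps (step (.contr Γ σ τ)) [t]))
    (h : Refutes ρ (Rule.contr Γ σ τ).concl (apps (step (.contr Γ σ τ)) [t]) ps B) :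
    RefutesPremiss ρ (.contr Γ σ τ) [t] ps B := by
  obtain ⟨ps₁, _, rfl, hΓ, p, rfl, hp⟩ := by
    simpa only [Rule.concl, List.map_eq_append_iff, List.map_eq_singleton_iff] using h.ant
  have hΓ' : Γ.length = ps₁.length := by simp [← hΓ]
  refine ⟨0, _, t, ps₁ ++ [p, p], B, rfl, rfl,
    ⟨by simp [hΓ, hp], h.suc, fun x hx => h.inputs x (by simp at hx ⊢; tauto), h.signed,
      h.out_of_conv hρ hc (conv_of_red (.contr (Γ := Γ) (σ := σ) (τ := τ) t p.1 (ps₁.map Prod.fst)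
        (by simp [hΓ'])) (by simp [← apps_append]) (by simp))⟩, ?_⟩
  clear h hc
  rintro _ _ (_ | _) A hA <;> grind [annotAt, Rule.principal]

/-- Either the cut value inhabits `σ` and becomes an input of the right premiss, or the left premiss
is refuted. Cut formulas are not ancestors, so fresh closure ordinals may be used. -/
theorem refutesPremiss_cut (hρ : ∀ n, IsCandidate (ρ n)) (hσ : σ.IsType)
    (hc : InClosure (apps (step (.cut Γ Δ σ τ)) [s, t]))
    (h : Refutes ρ (Rule.cut Γ Δ σ τ).concl (apps (step (.cut Γ Δ σ τ)) [s, t]) ps B) :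
    RefutesPremiss ρ (.cut Γ Δ σ τ) [s, t] ps B := by
  obtain ⟨ps₁, ps₂, rfl, hΓ, hΔ⟩ := by
    simpa only [Rule.concl, List.map_eq_append_iff] using h.ant
  have hΓ' : Γ.length = ps₁.length := by simp [← hΓ]
  have hΔ' : Δ.length = ps₂.length := by simp [← hΔ]
  by_cases hs : apps s (ps₁.map Prod.fst) ∈ interp σ ρ
  · refine ⟨1, _, t, ps₂ ++ [(apps s (ps₁.map Prod.fst), σ.annot true)], B, rfl, rfl,
      ⟨by simp [hΔ, Ty.erase_annot], h.suc, fun x hx => ?_, h.signed,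
        h.out_of_conv hρ hc (conv_of_red (.cut (Γ := Γ) (Δ := Δ) (σ := σ) (τ := τ) s t (ps₁.map Prod.fst) (ps₂.map Prod.fst)
          (by simp [hΓ']) (by simp [hΔ'])) (by simp [← apps_append]) (by simp))⟩, ?_⟩
    · rcases List.mem_append.1 hx with hx | hx
      · exact h.inputs x (by simp [hx])
      · obtain rfl := List.mem_singleton.1 hx
        exact ⟨(interp_annot hσ hρ).1 hs, Ty.signed_annot _ _⟩
    · clear h hc
      rintro _ _ (_ | _) A hA <;> grind [annotAt, Rule.principal]
  · refine ⟨0, _, s, ps₁, σ.annot false, rfl, rfl,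
      ⟨hΓ, Ty.erase_annot _ _, fun x hx => h.inputs x (by simp [hx]), Ty.signed_annot _ _,
        fun h' => hs ((interp_annot hσ hρ).2 h')⟩, ?_⟩
    clear h hc
    rintro _ _ (_ | _) A hA; grind [annotAt, Rule.principal]

/-- Failure at an arrow type provides an argument, the new input; the sign of its type flips as the
left-hand side requires. -/
theorem refutesPremiss_arrR (hρ : ∀ n, IsCandidate (ρ n))
    (hc : InClosure (apps (step (.arrR Γ σ τ)) [t]))
    (h : Refutes ρ (Rule.arrR Γ σ τ).concl (apps (step (.arrR Γ σ τ)) [t]) ps B) :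
    RefutesPremiss ρ (.arrR Γ σ τ) [t] ps B := by
  have hΓ : ps.map (fun p => p.2.erase) = Γ := h.ant
  have hΓ' : Γ.length = ps.length := by simp [← hΓ]
  have hB : B.erase = .arr σ τ := h.suc
  cases B with
  | arr B₁ B₂ =>
    obtain ⟨hB₁, hB₂⟩ := by simpa only [ATy.erase, Ty.arr.injEq] using hB
    obtain ⟨x, hx, hout⟩ : ∃ x ∈ interpA B₁ ρ,
        app (apps (apps (step (.arrR Γ σ τ)) [t]) (ps.map Prod.fst)) x ∉ interpA B₂ ρ := by
      by_contra! hne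
      exact h.out ⟨h.inClosure_apps hρ hc, hne⟩
    refine ⟨0, _, t, ps ++ [(x, B₁)], B₂, rfl, rfl,
      ⟨by simp [hΓ, hB₁], hB₂, fun y hy => ?_, h.signed.2,
        (isCandidate_interpA _ hρ).notMem_of_conv hout
          (.app (h.inClosure_apps hρ hc) ((isCandidate_interpA _ hρ).1 _ hx))
          (conv_of_red (.arrR (Γ := Γ) (σ := σ) (τ := τ) t x (ps.map Prod.fst) (by simp [hΓ']))
            (by simp [apps]) (by simp))⟩, ?_⟩
    · rcases List.mem_append.1 hy with hy | hy
      · exact h.inputs y hy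
      · obtain rfl := List.mem_singleton.1 hy
        exact ⟨hx, h.signed.1⟩
    · clear h hc hx hout
      rintro _ _ (_ | _) A hA <;> grind [annotAt, Rule.principal, ATy.Desc]
  | _ => cases hB

/-- If the argument computed by the left premiss has the domain type, applying `z` gives an input
for the right premiss; otherwise the left premiss is refuted. -/
theorem refutesPremiss_arrL (hρ : ∀ n, IsCandidate (ρ n))
    (hc : InClosure (apps (step (.arrL Γ Δ σ τ γ)) [s, t]))
    (h : Refutes ρ (Rule.arrL Γ Δ σ τ γ).concl (apps (step (.arrL Γ Δ σ τ γ)) [s, t]) ps B) :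
    RefutesPremiss ρ (.arrL Γ Δ σ τ γ) [s, t] ps B := by
  obtain ⟨_, _, rfl, ⟨ps₁, ps₂, rfl, hΓ, hΔ⟩, ⟨z, A⟩, rfl, hA⟩ := by
    simpa only [Rule.concl, List.map_eq_append_iff, List.map_eq_singleton_iff] using h.ant
  have hΓ' : Γ.length = ps₁.length := by simp [← hΓ]
  have hΔ' : Δ.length = ps₂.length := by simp [← hΔ]
  cases A with
  | arr A₁ A₂ =>
    obtain ⟨hA₁, hA₂⟩ := by simpa only [ATy.erase, Ty.arr.injEq] using hA
    obtain ⟨⟨-, hz⟩, hsz⟩ := h.inputs (z, A₁.arr A₂) (by simp)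
    by_cases hs : apps s (ps₁.map Prod.fst) ∈ interpA A₁ ρ
    · refine ⟨1, _, t, ps₂ ++ [(app z (apps s (ps₁.map Prod.fst)), A₂)], B, rfl, rfl,
        ⟨by simp [hΔ, hA₂], h.suc, fun x hx => ?_, h.signed,
          h.out_of_conv hρ hc (conv_of_red (.arrL (Γ := Γ) (Δ := Δ) (σ := σ) (τ := τ) (γ := γ) s t z (ps₁.map Prod.fst) (ps₂.map Prod.fst)
            (by simp [hΓ']) (by simp [hΔ'])) (by simp [← apps_append]) (by simp))⟩, ?_⟩
      · rcases List.mem_append.1 hx with hx | hx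
        · exact h.inputs x (by simp [hx])
        · obtain rfl := List.mem_singleton.1 hx
          exact ⟨hz _ hs, hsz.2⟩
      · clear h hc
        rintro _ _ (_ | _) A hA <;> grind [annotAt, Rule.principal, ATy.Desc]
    · refine ⟨0, _, s, ps₁, A₁, rfl, rfl,
        ⟨hΓ, hA₁, fun x hx => h.inputs x (by simp [hx]), hsz.1, hs⟩, ?_⟩
      clear h hc
      rintro _ _ (_ | _) A hA <;> grind [annotAt, Rule.principal, ATy.Desc]
  | _ => cases hA

/-- If both components were good so would be the pair, since projections with any type annotations
reduce on it. -/
theorem refutesPremiss_prodR (hρ : ∀ n, IsCandidate (ρ n))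
    (hc : InClosure (apps (step (.prodR Γ Δ σ τ)) [s, t]))
    (h : Refutes ρ (Rule.prodR Γ Δ σ τ).concl (apps (step (.prodR Γ Δ σ τ)) [s, t]) ps B) :
    RefutesPremiss ρ (.prodR Γ Δ σ τ) [s, t] ps B := by
  obtain ⟨ps₁, ps₂, rfl, hΓ, hΔ⟩ := by
    simpa only [Rule.concl, List.map_eq_append_iff] using h.ant
  have hΓ' : Γ.length = ps₁.length := by simp [← hΓ]
  have hΔ' : Δ.length = ps₂.length := by simp [← hΔ]
  have hB : B.erase = .prod σ τ := h.suc
  cases B with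
  | prod B₁ B₂ =>
    obtain ⟨hB₁, hB₂⟩ := by simpa only [ATy.erase, Ty.prod.injEq] using hB
    have hcl := h.inClosure_apps hρ hc
    have hred : Conv (apps (apps (step (.prodR Γ Δ σ τ)) [s, t]) ((ps₁ ++ ps₂).map Prod.fst))
        (pair σ τ (apps s (ps₁.map Prod.fst)) (apps t (ps₂.map Prod.fst))) :=
      conv_of_red (.prodR (Γ := Γ) (Δ := Δ) (σ := σ) (τ := τ) s t (ps₁.map Prod.fst)
        (ps₂.map Prod.fst) (by simp [hΓ']) (by simp [hΔ'])) (by simp [← apps_append]) rfl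
    by_cases hs : apps s (ps₁.map Prod.fst) ∈ interpA B₁ ρ
    · refine ⟨1, _, t, ps₂, B₂, rfl, rfl,
        ⟨hΔ, hB₂, fun x hx => h.inputs x (by simp [hx]), h.signed.2, fun ht => ?_⟩, ?_⟩
      · refine h.out ⟨hcl, fun σ' τ' hσ' hτ' => ⟨?_, ?_⟩⟩
        · exact (isCandidate_interpA _ hρ).2 _ hs _
            (.app (derives_proj₀ hσ' hτ').inClosure hcl)
            ((Conv.app (.refl _) hred).trans (.red (.proj₀ _ _))).symm
        · exact (isCandidate_interpA _ hρ).2 _ ht _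
            (.app (derives_proj₁ hσ' hτ').inClosure hcl)
            ((Conv.app (.refl _) hred).trans (.red (.proj₁ _ _))).symm
      · clear h hc hcl hred
        rintro _ _ (_ | _) A hA <;> grind [annotAt, Rule.principal, ATy.Desc]
    · refine ⟨0, _, s, ps₁, B₁, rfl, rfl,
        ⟨hΓ, hB₁, fun x hx => h.inputs x (by simp [hx]), h.signed.1, hs⟩, ?_⟩
      clear h hc hcl hred
      rintro _ _ (_ | _) A hA <;> grind [annotAt, Rule.principal, ATy.Desc]
  | _ => cases hB

theorem refutesPremiss_prodL (hρ : ∀ n, IsCandidate (ρ n)) (hσ : σ.IsType) (hτ : τ.IsType)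
    (hc : InClosure (apps (step (.prodL Γ σ τ γ)) [t]))
    (h : Refutes ρ (Rule.prodL Γ σ τ γ).concl (apps (step (.prodL Γ σ τ γ)) [t]) ps B) :
    RefutesPremiss ρ (.prodL Γ σ τ γ) [t] ps B := by
  obtain ⟨ps₁, _, rfl, hΓ, ⟨y, A⟩, rfl, hA⟩ := by
    simpa only [Rule.concl, List.map_eq_append_iff, List.map_eq_singleton_iff] using h.ant
  have hΓ' : Γ.length = ps₁.length := by simp [← hΓ]
  cases A with
  | prod A₁ A₂ =>
    obtain ⟨hA₁, hA₂⟩ := by simpa only [ATy.erase, Ty.prod.injEq] using hA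
    obtain ⟨⟨-, hy⟩, hsy⟩ := h.inputs (y, A₁.prod A₂) (by simp)
    obtain ⟨hy₁, hy₂⟩ := hy σ τ hσ hτ
    refine ⟨0, _, t, ps₁ ++ [(app (Coterm.proj₀ σ τ) y, A₁), (app (Coterm.proj₁ σ τ) y, A₂)], B,
      rfl, rfl, ⟨by simp [hΓ, hA₁, hA₂], h.suc, fun x hx => ?_, h.signed,
        h.out_of_conv hρ hc (conv_of_red (.prodL (Γ := Γ) (σ := σ) (τ := τ) (γ := γ) t y
          (ps₁.map Prod.fst) (by simp [hΓ'])) (by simp [← apps_append]) (by simp))⟩, ?_⟩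
    · rcases List.mem_append.1 hx with hx | hx
      · exact h.inputs x (by simp [hx])
      · rcases List.mem_pair.1 hx with rfl | rfl
        · exact ⟨hy₁, hsy.1⟩
        · exact ⟨hy₂, hsy.2⟩
    · clear h hc
      rintro _ _ (_ | _) A hA <;> grind [annotAt, Rule.principal, ATy.Desc]
  | _ => cases hA

theorem not_refutes_natZero (hc : InClosure (step .natZero))
    (h : Refutes ρ Rule.natZero.concl (step .natZero) ps B) : False := by
  obtain rfl : ps = [] := by simpa [Rule.concl] using h.ant
  have hB : B.erase = .nat := h.suc
  cases B with
  | nat o =>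
    obtain rfl : o = none := Option.isNone_iff_eq_none.1 (by simpa [ATy.Signed] using h.signed)
    exact h.out ⟨hc, 0, by simp, .refl _⟩
  | _ => cases hB

theorem refutesPremiss_natSucc (hρ : ∀ n, IsCandidate (ρ n))
    (hc : InClosure (apps (step (.natSucc Γ)) [t]))
    (h : Refutes ρ (Rule.natSucc Γ).concl (apps (step (.natSucc Γ)) [t]) ps B) :
    RefutesPremiss ρ (.natSucc Γ) [t] ps B := by
  have hΓ : ps.map (fun p => p.2.erase) = Γ := h.ant
  have hΓ' : Γ.length = ps.length := by simp [← hΓ]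
  have hB : B.erase = .nat := h.suc
  cases B with
  | nat o =>
    obtain rfl : o = none := Option.isNone_iff_eq_none.1 (by simpa [ATy.Signed] using h.signed)
    refine ⟨0, _, t, ps, .nat none, rfl, rfl, ⟨hΓ, rfl, h.inputs, h.signed, ?_⟩, ?_⟩
    -- A right-hand `N` is unannotated, so the larger numeral meets no bound.
    · rintro ⟨-, n, -, hn⟩
      exact h.out ⟨h.inClosure_apps hρ hc, n + 1, by simp,
        (conv_of_red (.natSucc (Γ := Γ) t (ps.map Prod.fst) (by simp [hΓ']))
          (by simp [← apps_append]) rfl).trans (.app (.refl _) hn)⟩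
    · have hd : ATy.Desc (.nat none) (.nat none) := .nat .none
      clear h hc
      rintro _ _ (_ | _) A hA <;> grind [annotAt, Rule.principal]
  | _ => cases hB

theorem apps_concat (t : Coterm) (xs : List Coterm) (x : Coterm) :
    apps t (xs ++ [x]) = app (apps t xs) x := apps_append t xs [x]

theorem refutesPremiss_natL (hρ : ∀ n, IsCandidate (ρ n))
    (hc : InClosure (apps (step (.natL Γ σ)) [s, t]))
    (h : Refutes ρ (Rule.natL Γ σ).concl (apps (step (.natL Γ σ)) [s, t]) ps B) :
    RefutesPremiss ρ (.natL Γ σ) [s, t] ps B := by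
  obtain ⟨ps₁, _, rfl, hΓ, ⟨y, A⟩, rfl, hA⟩ := by
    simpa only [Rule.concl, List.map_eq_append_iff, List.map_eq_singleton_iff] using h.ant
  have hΓ' : Γ.length = ps₁.length := by simp [← hΓ]
  cases A with
  | nat o =>
    obtain ⟨⟨-, n, hn, hy⟩, hsy⟩ := h.inputs (y, .nat o) (by simp)
    obtain ⟨α, rfl⟩ := Option.isSome_iff_exists.1 hsy
    have hconv : Conv (apps (apps (step (.natL Γ σ)) [s, t])
        ((ps₁ ++ [(y, ATy.nat (some α))]).map Prod.fst))
        (apps (apps (step (.natL Γ σ)) [s, t]) (ps₁.map Prod.fst ++ [numeral n])) := by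
      simp only [List.map_append, List.map_cons, List.map_nil, apps_concat]
      exact .app (.refl _) hy
    cases n with
    | zero =>
      refine ⟨0, _, s, ps₁, B, rfl, rfl,
        ⟨hΓ, h.suc, fun x hx => h.inputs x (by simp [hx]), h.signed,
          h.out_of_conv hρ hc (hconv.trans (conv_of_red (.natLZero (Γ := Γ) (σ := σ) s t
            (ps₁.map Prod.fst) (by simp [hΓ'])) (by simp [← apps_append]) rfl))⟩, ?_⟩
      clear h hc hconv
      rintro _ _ (_ | _) A hA <;> grind [annotAt, Rule.principal]
    -- The input converts to a numeral `n + 1 < α`, so `n + 1` is a smaller annotation that still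
    -- strictly bounds its predecessor.
    | succ n =>
      refine ⟨1, _, t, ps₁ ++ [(numeral n, .nat (some (n + 1 : ℕ)))], B, rfl, rfl,
        ⟨by simp [hΓ, ATy.erase], h.suc, fun x hx => ?_, h.signed,
          h.out_of_conv hρ hc (hconv.trans (conv_of_red (.natLSucc (Γ := Γ) (σ := σ) s t
            (numeral n) (ps₁.map Prod.fst) (by simp [hΓ'])) (by simp [← apps_append, numeral])
            (by simp)))⟩, ?_⟩
      · rcases List.mem_append.1 hx with hx | hx
        · exact h.inputs x (by simp [hx])
        · obtain rfl := List.mem_singleton.1 hx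
          refine ⟨⟨(derives_numeral n).inClosure, n, fun β hβ => ?_, .refl _⟩, rfl⟩
          obtain rfl := Option.mem_some.1 hβ
          exact Nat.cast_lt.2 n.lt_succ_self
      · have hd : ATy.Desc (.nat (some α)) (.nat (some (n + 1 : ℕ))) := .nat (.some (hn α rfl))
        clear h hc hconv
        rintro _ _ (_ | _) A hA <;> grind [annotAt, Rule.principal]
  | _ => cases hA

/-- The right-hand fixed point is unannotated, so closure under the operator is all that is needed.
-/
theorem refutesPremiss_muR (hρ : ∀ n, IsCandidate (ρ n)) (hσ : (Ty.mu σ).IsType)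
    (hc : InClosure (apps (step (.muR Γ σ)) [t]))
    (h : Refutes ρ (Rule.muR Γ σ).concl (apps (step (.muR Γ σ)) [t]) ps B) :
    RefutesPremiss ρ (.muR Γ σ) [t] ps B := by
  have hΓ : ps.map (fun p => p.2.erase) = Γ := h.ant
  have hΓ' : Γ.length = ps.length := by simp [← hΓ]
  have hB : B.erase = .mu σ := h.suc
  cases B with
  | mu o B =>
    obtain rfl : B.erase = σ := by simpa only [ATy.erase, Ty.mu.injEq] using hB
    obtain rfl : o = none := Option.isNone_iff_eq_none.1 (by simpa using h.signed.1)
    refine ⟨0, _, t, ps, B.inst (.mu none B), rfl, rfl,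
      ⟨hΓ, ATy.erase_inst _ _, h.inputs, h.signed.2.inst h.signed hσ.1, fun h' => ?_⟩, ?_⟩
    · rw [interpA_inst] at h'
      exact h.out_of_conv hρ hc (conv_of_red (.muR (Γ := Γ) (σ := B.erase) t (ps.map Prod.fst)
        (by simp [hΓ'])) (by simp [← apps_append]) rfl) (interpA_mu_closed hσ.2 hσ.1 ρ h')
    · have hd : ATy.Desc (.mu none B) (B.inst (.mu none B)) := .mu .none
      clear h hc
      rintro _ _ (_ | _) A hA <;> grind [annotAt, Rule.principal]
  | _ => cases hB

theorem refutesPremiss_muL (hρ : ∀ n, IsCandidate (ρ n)) (hσ : (Ty.mu σ).IsType)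
    (hc : InClosure (apps (step (.muL Γ σ τ)) [t]))
    (h : Refutes ρ (Rule.muL Γ σ τ).concl (apps (step (.muL Γ σ τ)) [t]) ps B) :
    RefutesPremiss ρ (.muL Γ σ τ) [t] ps B := by
  obtain ⟨ps₁, _, rfl, hΓ, ⟨y, A⟩, rfl, hA⟩ := by
    simpa only [Rule.concl, List.map_eq_append_iff, List.map_eq_singleton_iff] using h.ant
  have hΓ' : Γ.length = ps₁.length := by simp [← hΓ]
  cases A with
  | mu o A =>
    obtain rfl : A.erase = σ := by simpa only [ATy.erase, Ty.mu.injEq] using hA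
    obtain ⟨hy, hsy⟩ := h.inputs (y, .mu o A) (by simp)
    obtain ⟨α, rfl⟩ := Option.isSome_iff_exists.1 hsy.1
    -- The stage `β < α` at which `y` enters becomes the annotation of the unfolding.
    obtain ⟨β, hβ, hyβ⟩ := mem_approx.1 hy
    refine ⟨0, _, t, ps₁ ++ [(y, A.inst (.mu (some β) A))], B, rfl, rfl,
      ⟨by simp [hΓ, ATy.erase_inst, ATy.erase], h.suc, fun x hx => ?_, h.signed,
        h.out_of_conv hρ hc ?_⟩, ?_⟩
    · rcases List.mem_append.1 hx with hx | hx
      · exact h.inputs x (by simp [hx])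
      · obtain rfl := List.mem_singleton.1 hx
        exact ⟨(interpA_inst A (.mu (some β) A) ρ).symm ▸ hyβ,
          ATy.Signed.inst hsy.2 ⟨rfl, hsy.2⟩ hσ.1⟩
    -- The reduction clause consumes only the inputs for `Γ`; `y` is a further argument, restored by
    -- congruence.
    · simp only [List.map_append, List.map_cons, List.map_nil, apps_concat]
      exact .app (conv_of_red (.muL (Γ := Γ) (σ := A.erase) (τ := τ) t (ps₁.map Prod.fst)
        (by simp [hΓ'])) (by simp [← apps_append]) rfl) (.refl _)
    · have hd : ATy.Desc (.mu (some α) A) (A.inst (.mu (some β) A)) := .mu (.some hβ)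
      clear h hc
      rintro _ _ (_ | _) A hA <;> grind [annotAt, Rule.principal]
  | _ => cases hA

end Rules

/-- Local soundness: if the conclusion of a step is refuted, then so is some premiss. -/
theorem Refutes.premiss {ρ : ℕ → Set Coterm} {r : Rule} {ts : List Coterm}
    {ps : List (Coterm × ATy)} {B : ATy} (hρ : ∀ n, IsCandidate (ρ n)) (hr : r.WellFormed)
    (hlen : ts.length = r.arity)
    (hc : InClosure (apps (step r) ts)) (h : Refutes ρ r.concl (apps (step r) ts) ps B) :
    RefutesPremiss ρ r ts ps B := by
  simp only [Rule.WellFormed, List.forall_mem_cons] at hr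
  cases r with
  | id σ =>
    obtain rfl := List.length_eq_zero_iff.1 hlen
    exact (not_refutes_id hρ hr.1.2 hc h).elim
  | natZero =>
    obtain rfl := List.length_eq_zero_iff.1 hlen
    exact (not_refutes_natZero hc h).elim
  | exch Γ τ σ Δ γ =>
    obtain ⟨t, rfl⟩ := List.length_eq_one_iff.1 hlen
    exact refutesPremiss_exch hρ hc h
  | weak Γ σ τ =>
    obtain ⟨t, rfl⟩ := List.length_eq_one_iff.1 hlen
    exact refutesPremiss_weak hρ hc h
  | contr Γ σ τ =>
    obtain ⟨t, rfl⟩ := List.length_eq_one_iff.1 hlen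
    exact refutesPremiss_contr hρ hc h
  | arrR Γ σ τ =>
    obtain ⟨t, rfl⟩ := List.length_eq_one_iff.1 hlen
    exact refutesPremiss_arrR hρ hc h
  | prodL Γ σ τ γ =>
    obtain ⟨t, rfl⟩ := List.length_eq_one_iff.1 hlen
    have hστ := hr.1.1 (.prod σ τ) (by simp [Rule.concl])
    exact refutesPremiss_prodL hρ hστ.1 hστ.2 hc h
  | natSucc Γ =>
    obtain ⟨t, rfl⟩ := List.length_eq_one_iff.1 hlen
    exact refutesPremiss_natSucc hρ hc h
  | muR Γ σ =>
    obtain ⟨t, rfl⟩ := List.length_eq_one_iff.1 hlen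
    exact refutesPremiss_muR hρ hr.1.2 hc h
  | muL Γ σ τ =>
    obtain ⟨t, rfl⟩ := List.length_eq_one_iff.1 hlen
    exact refutesPremiss_muL hρ (hr.1.1 (.mu σ) (by simp [Rule.concl])) hc h
  | cut Γ Δ σ τ =>
    obtain ⟨s, t, rfl⟩ := List.length_eq_two.1 hlen
    exact refutesPremiss_cut hρ (hr.2 ⟨Γ, σ⟩ (by simp [Rule.prems])).2 hc h
  | arrL Γ Δ σ τ γ =>
    obtain ⟨s, t, rfl⟩ := List.length_eq_two.1 hlen
    exact refutesPremiss_arrL hρ hc h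
  | prodR Γ Δ σ τ =>
    obtain ⟨s, t, rfl⟩ := List.length_eq_two.1 hlen
    exact refutesPremiss_prodR hρ hc h
  | natL Γ σ =>
    obtain ⟨s, t, rfl⟩ := List.length_eq_two.1 hlen
    exact refutesPremiss_natL hρ hc h

/-! ### The branch of counterexamples and the infinite descent -/

theorem RuleTree.IsCMuLJ.kid {P : RuleTree} (h : P.IsCMuLJ) {i : ℕ} (hi : i < P.root.arity) :
    (P.kid i).IsCMuLJ := ((isCMuLJ_iff.1 h).2 i hi).2

/-- A refuted coderivation. -/
structure Counterexample (ρ : ℕ → Set Coterm) where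
  tree : RuleTree
  inputs : List (Coterm × ATy)
  out : ATy
  isCMuLJ : tree.IsCMuLJ
  refutes : Refutes ρ tree.concl tree.toCoterm inputs out

namespace Counterexample

variable {ρ : ℕ → Set Coterm}

/-- The annotated type at an occurrence in the conclusion. -/
def annot (c : Counterexample ρ) : Occ → Option ATy := annotAt c.inputs c.out

theorem erase_of_typeAt (c : Counterexample ρ) {p : Occ} {φ : Ty}
    (h : c.tree.concl.typeAt p = some φ) : ∃ A, c.annot p = some A ∧ A.erase = φ := by
  cases p with
  | lhs i =>
    rw [Sequent.typeAt, ← c.refutes.ant, List.getElem?_map, Option.map_eq_some_iff] at h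
    obtain ⟨q, hq, rfl⟩ := h
    exact ⟨q.2, by simp [annot, annotAt, hq], rfl⟩
  | rhs =>
    rw [Sequent.typeAt, Option.some.injEq] at h
    exact ⟨c.out, rfl, c.refutes.suc.trans h⟩

theorem typeAt_of_annot (c : Counterexample ρ) {p : Occ} {A : ATy}
    (h : c.annot p = some A) : c.tree.concl.typeAt p = some A.erase := by
  cases p with
  | lhs i =>
    simp only [annot, annotAt, Option.map_eq_some_iff] at h
    obtain ⟨q, hq, rfl⟩ := h
    rw [Sequent.typeAt, ← c.refutes.ant, List.getElem?_map, hq]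
    rfl
  | rhs =>
    obtain rfl := Option.some.inj h
    rw [Sequent.typeAt, ← c.refutes.suc]

theorem signed_lhs (c : Counterexample ρ) {i : ℕ} {A : ATy}
    (h : c.annot (.lhs i) = some A) : A.Signed true := by
  simp only [annot, annotAt, Option.map_eq_some_iff] at h
  obtain ⟨q, hq, rfl⟩ := h
  exact (c.refutes.inputs q (List.mem_of_getElem? hq)).2

/-- `c'` is at premiss number `b` of `c`, with the annotations following the ancestry. -/
def Next (c : Counterexample ρ) (b : ℕ) (c' : Counterexample ρ) : Prop :=
  b < c.tree.root.arity ∧ c'.tree = c.tree.kid b ∧ Traces c.tree.root b c.annot c'.annot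

theorem exists_next (hρ : ∀ n, IsCandidate (ρ n)) (c : Counterexample ρ) :
    ∃ b c', c.Next b c' := by
  have hP := isCMuLJ_iff.1 c.isCMuLJ
  have hc := InClosure.base c.isCMuLJ
  have h := c.refutes
  rw [toCoterm_eq_kid] at hc h
  obtain ⟨j, S, t, ps, B, hS, ht, href, htr⟩ := h.premiss hρ hP.1 (by simp) hc
  simp only [List.getElem?_map, Option.map_eq_some_iff, List.getElem?_eq_some_iff,
    List.length_range, List.getElem_range] at ht
  obtain ⟨_, ⟨hj, rfl⟩, rfl⟩ := ht
  obtain ⟨hS', hk⟩ := hP.2 j hj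
  obtain rfl := Option.some.inj (hS.symm.trans hS')
  exact ⟨j, ⟨_, ps, B, hk, href⟩, hj, rfl, htr⟩

/-- A counterexample gives an infinite branch of counterexamples. -/
theorem exists_branch (hρ : ∀ n, IsCandidate (ρ n)) (c : Counterexample ρ) :
    ∃ (C : ℕ → Counterexample ρ) (b : ℕ → ℕ), C 0 = c ∧ ∀ n, (C n).Next (b n) (C (n + 1)) := by
  choose b next h using exists_next hρ
  exact ⟨fun n => next^[n] c, fun n => b (next^[n] c), rfl, fun n => by
    simpa only [Function.iterate_succ_apply'] using h (next^[n] c)⟩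

theorem sub_tree {C : ℕ → Counterexample ρ} {b : ℕ → ℕ}
    (hC : ∀ n, (C n).Next (b n) (C (n + 1))) (n : ℕ) : Sub (C 0).tree (C n).tree := by
  have h : ∀ n Q, Sub (C n).tree Q → Sub (C 0).tree Q := by
    intro n
    induction n with
    | zero => exact fun Q h => h
    | succ n ih => exact fun Q h => ih Q (.kid _ (hC n).1 ((hC n).2.1 ▸ h))
  exact h n _ (.refl _)

/-- In a regular coderivation, the formulas that are principal arbitrarily late are principal
infinitely often. -/
theorem eventually_principal {C : ℕ → Counterexample ρ} {b : ℕ → ℕ} {θ : ℕ → Occ}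
    (hC : ∀ n, (C n).Next (b n) (C (n + 1))) :
    ∀ᶠ n in Filter.atTop, ∀ ψ, PrincipalAt (fun n => (C n).tree) θ ψ n →
      ∃ᶠ m in Filter.atTop, PrincipalAt (fun n => (C n).tree) θ ψ m := by
  let S : Set Ty := {ψ | ∃ n, PrincipalAt (fun n => (C n).tree) θ ψ n}
  -- A principal formula can be read off the subtree at its node, and there are finitely many
  -- subtrees; the default `.nat` is never used where the thread is principal.
  have hS : S.Finite := by
    refine Set.Finite.subset ((C 0).isCMuLJ.2.1.image fun Q =>
      ((Q.root.principal.bind Q.concl.typeAt).getD .nat)) ?_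
    rintro ψ ⟨n, h₁, h₂⟩
    refine ⟨(C n).tree, sub_tree hC n, ?_⟩
    simp [h₁, h₂]
  have key : ∀ᶠ n in Filter.atTop, ∀ ψ ∈ S, PrincipalAt (fun n => (C n).tree) θ ψ n →
      ∃ᶠ m in Filter.atTop, PrincipalAt (fun n => (C n).tree) θ ψ m := by
    refine (Set.Finite.eventually_all hS).2 fun ψ _ => ?_
    by_cases h : ∃ᶠ m in Filter.atTop, PrincipalAt (fun n => (C n).tree) θ ψ m
    · exact .of_forall fun _ _ => h
    · exact (Filter.not_frequently.1 h).mono fun n hn h' => absurd h' hn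
  exact key.mono fun n hn ψ hψ => hn ψ ⟨n, hψ⟩ hψ

/-- Along a thread whose principal formulas all contain `φ`, the annotations of `φ` decrease whenever
`φ` is principal. -/
theorem not_frequently_principal {C : ℕ → Counterexample ρ} {b : ℕ → ℕ} {θ : ℕ → Occ} {φ : Ty}
    (hC : ∀ n, (C n).Next (b n) (C (n + 1))) (hφ : φ.IsMu) {k : ℕ}
    (hθ : IsThread (fun n => (C n).tree) b k θ)
    (hmin : ∀ n, k ≤ n → ∀ ψ, PrincipalAt (fun n => (C n).tree) θ ψ n → φ.size ≤ ψ.size)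
    (hfr : ∃ᶠ n in Filter.atTop, PrincipalAt (fun n => (C n).tree) θ φ n)
    (β : Ordinal.{0}) : ∀ n A, k ≤ n → (C n).annot (θ n) = some A → ¬ A.Bounded φ β := by
  induction β using WellFoundedLT.induction with
  | ind β ih =>
    intro n A hn hA hB
    -- By the induction hypothesis no smaller bound occurs later, so `φ` is not principal at `m` and
    -- the bound `β` passes to the next node.
    have step : ∀ m A, k ≤ m → (C m).annot (θ m) = some A → A.Bounded φ β →
        ¬ PrincipalAt (fun n => (C n).tree) θ φ m ∧
          ∃ A', (C (m + 1)).annot (θ (m + 1)) = some A' ∧ A'.Bounded φ β := by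
      intro m A hm hA hB
      obtain ⟨A', hA', hd, he⟩ := (hC m).2.2 _ _ (hθ m hm) A hA
      have htype := (C m).typeAt_of_annot hA
      by_cases hp : (C m).tree.root.principal = some (θ m)
      · have hne : A.erase ≠ φ := fun e => by
          obtain ⟨β', hβ', hB'⟩ := hB.desc_self hφ (hd hp) e
          exact ih β' hβ' (m + 1) A' (by omega) hA' hB'
        exact ⟨fun h => hne (Option.some.inj (htype.symm.trans h.2)), A', hA',
          hB.desc (hmin m hm _ ⟨hp, htype⟩) (hd hp) hne⟩
      · exact ⟨fun h => hp h.1, A', hA', he hp ▸ hB⟩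
    have hall : ∀ j, ∃ A, (C (n + j)).annot (θ (n + j)) = some A ∧ A.Bounded φ β := by
      intro j
      induction j with
      | zero => exact ⟨A, hA, hB⟩
      | succ j ihj =>
        obtain ⟨A, hA, hB⟩ := ihj
        exact (step _ A (by omega) hA hB).2
    obtain ⟨m, hm, hp⟩ := Filter.frequently_atTop.1 hfr n
    obtain ⟨j, rfl⟩ := Nat.exists_eq_add_of_le hm
    obtain ⟨A, hA, hB⟩ := hall j
    exact (step _ A (by omega) hA hB).1 hp

/-- At a late left-hand unfolding of the thread's smallest formula the traced type is bounded by an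
ordinal, against `not_frequently_principal`. -/
theorem isEmpty (hρ : ∀ n, IsCandidate (ρ n)) : IsEmpty (Counterexample ρ) := by
  refine ⟨fun c => ?_⟩
  obtain ⟨C, b, -, hC⟩ := exists_branch hρ c
  obtain ⟨k, θ, hθ, φ, hφ, hleft, hmin⟩ := (C 0).isCMuLJ.2.2 (fun n => (C n).tree) b
    (isBranch_iff.2 ⟨rfl, fun n => ⟨(hC n).1, (hC n).2.1⟩⟩)
  obtain ⟨k', hk'⟩ := Filter.eventually_atTop.1 (eventually_principal (θ := θ) hC)
  -- Beyond `k` the thread is defined; beyond `k'` each of its principal formulas recurs infinitely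
  -- often, hence contains the smallest one.
  obtain ⟨n, hn, ⟨-, hp⟩, i, hi⟩ := Filter.frequently_atTop.1 hleft (max k k')
  obtain ⟨A, hA, rfl⟩ := (C n).erase_of_typeAt hp
  obtain ⟨β, hβ⟩ := ATy.Signed.bounded_self ((C n).signed_lhs (hi ▸ hA)) hφ
  refine not_frequently_principal hC hφ (k := max k k')
    (fun m hm => hθ m ((le_max_left _ _).trans hm))
    (fun m hm ψ hψ => (hmin ψ (hk' m ((le_max_right _ _).trans hm) ψ hψ)).size_le)
    (hleft.mono fun _ h => h.1) β n A hn hA hβ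

end Counterexample

/-! ### Interpretation and totality -/

/-- Coderivations inhabit their conclusions. -/
theorem apps_mem_interp {P : RuleTree} {ρ : ℕ → Set Coterm} {ss : List Coterm} (hP : P.IsCMuLJ)
    (hρ : ∀ n, IsCandidate (ρ n))
    (hss : List.Forall₂ (fun s σ => s ∈ interp σ ρ) ss P.concl.ant) :
    apps P.toCoterm ss ∈ interp P.concl.suc ρ := by
  by_contra hne
  have hw := (isCMuLJ_iff.1 hP).1 P.concl (by simp [RuleTree.concl])
  have hlen := hss.length_eq
  -- The initial counterexample annotates both sides by closure ordinals.
  refine (Counterexample.isEmpty hρ).false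
    ⟨P, ss.zip (P.concl.ant.map (Ty.annot true)), P.concl.suc.annot false, hP,
      ⟨?_, Ty.erase_annot _ _, ?_, Ty.signed_annot _ _, ?_⟩⟩
  · have h : (fun p : Coterm × ATy => p.2.erase) = ATy.erase ∘ Prod.snd := rfl
    rw [h, ← List.map_map, List.map_snd_zip (by simp [hlen]), List.map_map]
    refine (List.map_congr_left fun σ _ => ?_).trans (List.map_id _)
    exact Ty.erase_annot _ _
  · intro p hp
    rw [List.zip_map_right, List.mem_map] at hp
    obtain ⟨⟨s, σ⟩, hp, rfl⟩ := hp
    exact ⟨(interp_annot (hw.1 σ (List.of_mem_zip hp).2) hρ).1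
      ((List.forall₂_iff_zip.1 hss).2 hp), Ty.signed_annot _ _⟩
  · rw [List.map_fst_zip (by simp [hlen])]
    exact fun h => hne ((interp_annot hw.2 hρ).2 h)

/-- A cut with empty left context appends its numeral to the `d` inputs already supplied, so the
induction generalises over those. -/
theorem conv_cutNumerals (t : Coterm) (ms : List ℕ) (d : ℕ) (ys : List Coterm)
    (hys : ys.length = d) :
    Conv (apps (cutNumerals t d ms) ys) (apps t (ys ++ ms.map numeral)) := by
  induction ms generalizing d ys with
  | nil => simpa [cutNumerals] using Conv.refl _
  | cons m ms ih =>
    refine (conv_of_red (.cut (Γ := []) (Δ := List.replicate d .nat) (σ := .nat) (τ := .nat)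
      (numeral m) (cutNumerals t (d + 1) ms) [] ys rfl (by simp [hys]))
      (by simp [cutNumerals, ← apps_append]) rfl).trans ?_
    simpa [apps] using ih (d + 1) (ys ++ [numeral m]) (by simp [hys])

theorem exists_conv_numeral {k : ℕ} {P : RuleTree} (hP : P.IsCMuLJ)
    (hc : P.concl = ⟨List.replicate k .nat, .nat⟩) (m : Fin k → ℕ) :
    ∃ n, Conv (apps P.toCoterm ((List.ofFn m).map numeral)) (numeral n) := by
  -- Any assignment of candidates would do, as only the closed type `N` occurs.
  have h := apps_mem_interp (ρ := fun _ => {t | InClosure t}) (ss := (List.ofFn m).map numeral) hP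
    (fun _ => isCandidate_inClosure) (by
      rw [hc, List.forall₂_iff_get]
      refine ⟨by simp, fun i h₁ h₂ => ?_⟩
      simp only [List.get_eq_getElem, List.getElem_map, List.getElem_replicate]
      exact ⟨(derives_numeral _).inClosure, _, .refl _⟩)
  rw [hc] at h
  exact h.2

end MuLJ

open MuLJ Coterm in
theorem mainTheorem3 :
    -- every type is interpreted by a candidate, in particular by a set closed under conversion
    (∀ (τ : Ty) (ρ : ℕ → Set Coterm), τ.IsType → (∀ n, IsCandidate (ρ n)) →
      IsCandidate (interp τ ρ)) ∧
    -- `μ`-types are interpreted by least fixed points on candidates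
    (∀ (σ : Ty) (ρ : ℕ → Set Coterm), (Ty.mu σ).IsType → (∀ n, IsCandidate (ρ n)) →
      IsLeast {A | IsCandidate A ∧ interp σ (extend A ρ) = A} (interp (.mu σ) ρ)) ∧
    -- interpretation of coderivations
    (∀ (P : RuleTree) (ρ : ℕ → Set Coterm) (ss : List Coterm), P.IsCMuLJ →
      (∀ n, IsCandidate (ρ n)) →
      List.Forall₂ (fun s σ => s ∈ interp σ ρ) ss P.concl.ant →
      apps P.toCoterm ss ∈ interp P.concl.suc ρ) ∧
    -- totality
    (∀ (k : ℕ) (P : RuleTree), P.IsCMuLJ → P.concl = ⟨List.replicate k .nat, .nat⟩ →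
      ∀ m : Fin k → ℕ, ∃ n,
        Conv (apps P.toCoterm ((List.ofFn m).map numeral)) (numeral n)) ∧
    (∀ (k : ℕ) (P : RuleTree) (f : (Fin k → ℕ) →. ℕ), P.IsCMuLJ → Represents P f →
      ∀ m, (f m).Dom) := by
  refine ⟨fun τ ρ _ hρ => isCandidate_interp τ hρ, fun σ ρ hσ hρ => ⟨⟨?_, ?_⟩, ?_⟩,
    fun P ρ ss hP hρ hss => apps_mem_interp hP hρ hss,
    fun k P hP hc m => exists_conv_numeral hP hc m, fun k P f hP hf m => ?_⟩
  · exact isCandidate_interp _ hρ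
  -- By monotonicity, the operator applied to its least closed candidate is again a closed
  -- candidate, hence contains it.
  · refine (interp_mu_closed hσ ρ).antisymm (Set.sInter_subset_of_mem ⟨?_, ?_⟩)
    · exact isCandidate_interp σ ((isCandidate_interp (.mu σ) hρ).extend hρ)
    · exact interp_monotone hσ ρ (interp_mu_closed hσ ρ)
  · exact fun A hA => Set.sInter_subset_of_mem ⟨hA.1, hA.2.le⟩
  · by_contra hd
    obtain ⟨n, hn⟩ := exists_conv_numeral hP hf.1 m
    exact (hf.2 m).2 hd n ((conv_cutNumerals P.toCoterm (List.ofFn m) 0 [] rfl).trans hn)
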